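/- Let $n,p\ge 0$ be integers and let $a,c$ be real numbers with $c>0$. View $S^{2n+1}\times S^{2p+1}\subset\mathbb C^{n+1}\times\mathbb C^{p+1}$ as the homogeneous space $U(n+1)/U(n)\times U(p+1)/U(p)$, with base point $o=(e_0,e_0)$. Let $\mathfrak p=\mathfrak p_1\times\mathfrak p_2\subset\mathfrak u(n+1)\times\mathfrak u(p+1)$, where, with the rows and columns of matrices numbered from $0$ and $E_{jk}$ the matrix units, $\mathfrak p_1$ has the basis $X^1=iE_{00}$, $Y^1_{2\nu-1}=E_{\nu0}-E_{0\nu}$, $Y^1_{2\nu}=i(E_{\nu0}+E_{0\nu})$ $(1\le\nu\le n)$, and $\mathfrak p_2$ has the basis $X^2$, $Y^2_{2\nu-1}$, $Y^2_{2\nu}$ $(1\le\nu\le p)$ defined in the same way; $\mathfrak p$ is identified with the tangent space at $o$ by $A\mapsto A\cdot o$. Let $\omega$ be the invariant $2$-form and $I(a,c)$ the invariant complex structure which are given at $o$ by $$\omega=X^1\wedge X^2+\sum_{\nu=1}^nY^1_{2\nu-1}\wedge Y^1_{2\nu}+\sum_{\nu=1}^pY^2_{2\nu-1}\wedge Y^2_{2\nu},$$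 $$I(a,c)X^1=\tfrac ac X^1+\tfrac1cX^2,\quad I(a,c)X^2=-\tfrac{a^2+c^2}{c}X^1-\tfrac ac X^2,\quad I(a,c)Y^j_{2\nu-1}=Y^j_{2\nu},$$ where the wedge products in $\omega$ are those of the dual basis, and let $g(a,c)(u,v)=\omega(u,I(a,c)v)$ be the associated invariant Riemannian metric. Consider the orthonormal basis of $\mathfrak p$ $$Z_0=\sqrt c\,X^1,\quad Z_\nu=Y^1_\nu\ (1\le\nu\le2n),\quad Z_{2n+1}=\tfrac{a}{\sqrt c}X^1+\tfrac1{\sqrt c}X^2,\quad Z_{2n+1+\mu}=Y^2_\mu\ (1\le\mu\le2p).$$ Let $R(X,Y)=[D_X,D_Y]-D_{[X,Y]}$ be the curvature at $o$ of the Levi-Civita connection $D$ of $g(a,c)$, and put $R_{(\alpha\nu)(\rho\mu)}=g(a,c)(R(Z_\alpha,Z_\nu)Z_\mu,Z_\rho)$ for $0\le\alpha<\nu\le2n+2p+1$ and $0\le\rho<\mu\le2n+2p+1$. Then $$R_{(0\nu)(\rho\mu)}=\begin{cases}\frac1c,&\rho=0,\ \nu=\mu\in\{1,\dots,2n\},\\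 \frac{a^2}{c},&\rho=0,\ \nu=\mu\in\{2n+2,\dots,2n+2p+1\},\\ -a,&\rho=2n+1,\ \nu=\mu\in\{2n+2,\dots,2n+2p+1\},\\ 0&\text{for all other }\nu>0\text{ and }\rho<\mu,\end{cases}$$ $$R_{(2n+1\,\nu)(\rho\mu)}=\begin{cases}-a,&\rho=0,\ \nu=\mu\in\{2n+2,\dots,2n+2p+1\},\\ c,&\rho=2n+1,\ \nu=\mu\in\{2n+2,\dots,2n+2p+1\},\\ 0&\text{for all other }\nu>2n+1\text{ and }\rho<\mu.\end{cases}$$ -/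

import Mathlib

open scoped Manifold ContDiff Matrix

noncomputable section

/-! ### Levi-Civita connections and their curvature -/

section Connection

variable {E : Type*} [NormedAddCommGroup E] [NormedSpace ℝ E] [FiniteDimensional ℝ E]
  [CompleteSpace E] {H : Type*} [TopologicalSpace H] {I : ModelWithCorners ℝ E H}
  {M : Type*} [TopologicalSpace M] [ChartedSpace H M]

/-- `X` is a smooth vector field. -/
def IsSmoothVectorField [IsManifold I 1 M] (X : (x : M) → TangentSpace I x) : Prop :=
  ContMDiff I I.tangent ∞ (fun x => (⟨x, X x⟩ : TangentBundle I M))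

/-- The field of bilinear forms `g` is parallel for the connection `D`:
`X (g (Y, Z)) = g (D_X Y, Z) + g (Y, D_X Z)`. In Mathlib's notation `D Y x (X x)` is the value
of `D_X Y` at `x`. -/
def IsCompatibleWith [IsManifold I 1 M]
    (D : CovariantDerivative I E (TangentSpace I : M → Type _))
    (g : (x : M) → TangentSpace I x → TangentSpace I x → ℝ) : Prop :=
  ∀ X Y Z : (x : M) → TangentSpace I x,
    IsSmoothVectorField X → IsSmoothVectorField Y → IsSmoothVectorField Z → ∀ x : M,
      mvfderiv I (fun y => g y (Y y) (Z y)) x (X x)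
        = g x (D Y x (X x)) (Z x) + g x (Y x) (D Z x (X x))

/-- `D` is the Levi-Civita (Riemannian) connection of the metric `g`: it is smooth, torsion-free
and `g` is parallel. -/
structure IsLeviCivita [IsManifold I 2 M]
    (D : CovariantDerivative I E (TangentSpace I : M → Type _))
    (g : (x : M) → TangentSpace I x → TangentSpace I x → ℝ) : Prop where
  smooth : D.ContMDiffCovariantDerivative ∞
  torsion_free : D.torsion = 0
  compatible : IsCompatibleWith D g

/-- The curvature `R(X, Y) W = D_X D_Y W - D_Y D_X W - D_{[X, Y]} W`. -/
def curvature [IsManifold I 2 M] (D : CovariantDerivative I E (TangentSpace I : M → Type _))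
    (X Y W : (x : M) → TangentSpace I x) (x : M) : TangentSpace I x :=
  D (fun y => D W y (Y y)) x (X x) - D (fun y => D W y (X y)) x (Y x)
    - D W x (VectorField.mlieBracket I X Y x)

end Connection

namespace SphereProduct

/-! ### The product of spheres `S²ⁿ⁺¹ × S²ᵖ⁺¹ = U(n+1)/U(n) × U(p+1)/U(p)` -/

/-- The Hermitian space `ℂᵐ⁺¹`, with coordinates numbered `0, …, m`. -/
abbrev Cn (m : ℕ) : Type := EuclideanSpace ℂ (Fin (m + 1))

instance finrankFact (m : ℕ) : Fact (Module.finrank ℝ (Cn m) = (2 * m + 1) + 1) :=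
  ⟨by
    rw [← Module.finrank_mul_finrank ℝ ℂ (Cn m), finrank_euclideanSpace, Complex.finrank_real_complex,
      Fintype.card_fin]
    ring⟩

/-- The unit sphere `S²ᵐ⁺¹` in `ℂᵐ⁺¹`. -/
abbrev Sph (m : ℕ) : Type := Metric.sphere (0 : Cn m) 1

/-- The manifold `S²ⁿ⁺¹ × S²ᵖ⁺¹`. -/
abbrev Mfd (n p : ℕ) : Type := Sph n × Sph p

/-- The vector space on which `S²ⁿ⁺¹ × S²ᵖ⁺¹` is modelled. -/
abbrev Model (n p : ℕ) : Type :=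
  EuclideanSpace ℝ (Fin (2 * n + 1)) × EuclideanSpace ℝ (Fin (2 * p + 1))

/-- The model with corners (without boundary) of `S²ⁿ⁺¹ × S²ᵖ⁺¹`. -/
abbrev Mdl (n p : ℕ) : ModelWithCorners ℝ (Model n p)
    (ModelProd (EuclideanSpace ℝ (Fin (2 * n + 1))) (EuclideanSpace ℝ (Fin (2 * p + 1)))) :=
  (𝓡 (2 * n + 1)).prod (𝓡 (2 * p + 1))

/-- The ambient space `ℂⁿ⁺¹ × ℂᵖ⁺¹`. -/
abbrev Amb (n p : ℕ) : Type := Cn n × Cn p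

variable {n p : ℕ}

/-- The inclusion `S²ⁿ⁺¹ × S²ᵖ⁺¹ ⊂ ℂⁿ⁺¹ × ℂᵖ⁺¹`. -/
def incl (q : Mfd n p) : Amb n p := (q.1, q.2)

/-- A tangent vector of `S²ⁿ⁺¹ × S²ᵖ⁺¹` seen as a vector of `ℂⁿ⁺¹ × ℂᵖ⁺¹`, through the derivative of
the inclusion. -/
def ambient (q : Mfd n p) (v : TangentSpace (Mdl n p) q) : Amb n p :=
  mvfderiv (Mdl n p) (incl (n := n) (p := p)) q v

/-- The base point `(e₀, e₀)`, whose stabilizer is `U(n) × U(p)`. -/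
def base (n p : ℕ) : Mfd n p :=
  (⟨EuclideanSpace.single 0 1, by simp⟩, ⟨EuclideanSpace.single 0 1, by simp⟩)

/-! ### The invariant 2-form, complex structures and metrics

At the point `z` of a sphere the tangent space is the sum of the line `ℝ i z`, tangent to the Hopf
fibre, and of the complex orthogonal complement of `z`. -/

/-- The coordinate of `v` along `i z`. -/
def fib {m : ℕ} (z v : Cn m) : ℝ := (inner ℂ z v).im

/-- The component of `v` in the complex orthogonal complement of `z`. -/
def hor {m : ℕ} (z v : Cn m) : Cn m := v - (inner ℂ z v : ℂ) • z

/-- The 2-form `ω = X¹ ∧ X² + ∑ Y¹_{2ν-1} ∧ Y¹_{2ν} + ∑ Y²_{2ν-1} ∧ Y²_{2ν}` at the point `q`. -/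
def omega (q u v : Amb n p) : ℝ :=
  (fib q.1 u.1 * fib q.2 v.2 - fib q.2 u.2 * fib q.1 v.1)
    + (inner ℂ (hor q.1 u.1) (hor q.1 v.1)).im + (inner ℂ (hor q.2 u.2) (hor q.2 v.2)).im

/-- The complex structure `I(a, c)` at the point `q`: with `X¹ = (i z, 0)` and `X² = (0, i w)` at
`q = (z, w)`, it sends `X¹` to `(a/c) X¹ + (1/c) X²` and `X²` to `-((a² + c²)/c) X¹ - (a/c) X²`, and is
the multiplication by `i` on the horizontal vectors, so that `Y_{2ν-1}` goes to `Y_{2ν}`. -/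
def cplx (a c : ℝ) (q v : Amb n p) : Amb n p :=
  ((((a / c) * fib q.1 v.1 - ((a ^ 2 + c ^ 2) / c) * fib q.2 v.2 : ℝ) : ℂ) • Complex.I • q.1
      + Complex.I • hor q.1 v.1,
    (((1 / c) * fib q.1 v.1 - (a / c) * fib q.2 v.2 : ℝ) : ℂ) • Complex.I • q.2
      + Complex.I • hor q.2 v.2)

/-- `ω` is invariant under `U(n+1) × U(p+1)`. -/
theorem omega_invariant (A : Cn n ≃ₗᵢ[ℂ] Cn n) (B : Cn p ≃ₗᵢ[ℂ] Cn p) (q u v : Amb n p) :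
    omega (A q.1, B q.2) (A u.1, B u.2) (A v.1, B v.2) = omega q u v := by
  simp only [omega, fib, hor, ← map_smul, ← map_sub, LinearIsometryEquiv.inner_map_map]

/-- `I(a, c)` is invariant under `U(n+1) × U(p+1)`. -/
theorem cplx_invariant (a c : ℝ) (A : Cn n ≃ₗᵢ[ℂ] Cn n) (B : Cn p ≃ₗᵢ[ℂ] Cn p) (q v : Amb n p) :
    cplx a c (A q.1, B q.2) (A v.1, B v.2) = (A (cplx a c q v).1, B (cplx a c q v).2) := by
  simp only [cplx, fib, hor, map_add, map_sub, map_smul, LinearIsometryEquiv.inner_map_map]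

/-- The metric `g(a, c)`, associated with `ω` and `I(a, c)`: `g(u, v) = ω(u, I(a, c) v)`. -/
def metric (a c : ℝ) (q : Mfd n p) (u v : TangentSpace (Mdl n p) q) : ℝ :=
  omega (incl q) (ambient q u) (cplx a c (incl q) (ambient q v))

/-! ### The subspace `𝔭` of the Lie algebra `𝔲(n+1) × 𝔲(p+1)` -/

/-- The matrix with `1` in the place `(j, k)` and zeros elsewhere. -/
def elem (m j k : ℕ) : Matrix (Fin (m + 1)) (Fin (m + 1)) ℂ :=
  Matrix.of fun r s => if (r : ℕ) = j ∧ (s : ℕ) = k then 1 else 0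

/-- `X = (i / 2) T_{00}`, where `T_{jk} = E_{jk} + E_{kj}`. -/
def vX (m : ℕ) : Matrix (Fin (m + 1)) (Fin (m + 1)) ℂ :=
  (Complex.I / 2) • (elem m 0 0 + elem m 0 0)

/-- `Y_{2ν-1} = E_{ν0} - E_{0ν}` and `Y_{2ν} = i (E_{ν0} + E_{0ν})`, for `ν = 1, …, m`. -/
def vY (m k : ℕ) : Matrix (Fin (m + 1)) (Fin (m + 1)) ℂ :=
  if Odd k then elem m ((k + 1) / 2) 0 - elem m 0 ((k + 1) / 2)
  else Complex.I • (elem m (k / 2) 0 + elem m 0 (k / 2))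

/-- The Lie algebra element `Z_k` of `𝔭`, for `k = 0, …, 2n + 2p + 1`. -/
def vZ (n p : ℕ) (a c : ℝ) (k : ℕ) :
    Matrix (Fin (n + 1)) (Fin (n + 1)) ℂ × Matrix (Fin (p + 1)) (Fin (p + 1)) ℂ :=
  if k = 0 then (√c • vX n, 0)
  else if k ≤ 2 * n then (vY n k, 0)
  else if k = 2 * n + 1 then ((a / √c) • vX n, (1 / √c) • vX p)
  else (0, vY p (k - (2 * n + 1)))

/-- The derivative at `t = 0` of `exp (t A) q`: the infinitesimal action of the Lie algebra. -/
def act (A : Matrix (Fin (n + 1)) (Fin (n + 1)) ℂ × Matrix (Fin (p + 1)) (Fin (p + 1)) ℂ)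
    (q : Amb n p) : Amb n p :=
  (WithLp.toLp 2 (A.1 *ᵥ q.1.ofLp), WithLp.toLp 2 (A.2 *ᵥ q.2.ofLp))

/-- The tangent vector `v` at the base point is the one identified with the element `A` of `𝔭`. -/
def Represents (v : TangentSpace (Mdl n p) (base n p))
    (A : Matrix (Fin (n + 1)) (Fin (n + 1)) ℂ × Matrix (Fin (p + 1)) (Fin (p + 1)) ℂ) : Prop :=
  ambient (base n p) v = act A (incl (base n p))

/-- The component `R_{(αν)(ρμ)} = g(R(Z_α, Z_ν) Z_μ, Z_ρ)` at the base point of the curvature of the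
connection `D`, for vector fields `Z_0, Z_1, …`. -/
def curvComp (a c : ℝ)
    (D : CovariantDerivative (Mdl n p) (Model n p) (TangentSpace (Mdl n p) : Mfd n p → Type _))
    (Z : ℕ → (q : Mfd n p) → TangentSpace (Mdl n p) q) (α ν ρ μ : ℕ) : ℝ :=
  metric a c (base n p) (curvature D (Z α) (Z ν) (Z μ) (base n p)) (Z ρ (base n p))

end SphereProduct

end

/-! The computation takes place in `ℂⁿ⁺¹ × ℂᵖ⁺¹`: a vector field `Y` becomes the vector-valued
function `hat Y`, and on tangent vectors `g(a, c)` is the restriction of `gram`, the product of the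
round metrics plus a correction in the two Hopf directions (`metric_eq_gram`).

The Levi-Civita connection is then `d + chr`. In each factor the term `Re⟨u, v⟩ z` of `chr` cancels
the normal part of the flat derivative, and the two terms in `i hor` come from differentiating the
coordinate along `i z`. The form `chr` is symmetric and compatible with `gram`
(`gram_chr_add_gram_chr`). Hence the difference between `D` and `d + chr` is symmetric in its two
fields and skew for the metric, so it vanishes by the Koszul argument (`gram_defect`,
`ambient_cov`).

The curvature becomes algebraic: derivatives of `chr` in the base point plus commutators of `chr`
(`ambient_curvature`). When its first argument `u` is tangent to the torus fibre, it splits into one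
term per factor, `mom(u) (Re⟨hor v, hor w⟩ i z - mom(w) hor v)`, where `mom` is the product with
`X¹` or `X²` (`gram_curvature`). Both `Z_0` and `Z_{2n+1}` are such vectors. With the values of
`mom` on the basis and the orthonormality of the `Y`, every component is a product of two values of
`mom`; the subtracted terms vanish because `ρ < μ`. -/

noncomputable section

/-! ### Calculus on manifolds: directional derivatives, brackets, extension of vectors -/

section Manifold
open Bundle VectorField Filter Topology

variable {E : Type*} [NormedAddCommGroup E] [NormedSpace ℝ E]
  {H : Type*} [TopologicalSpace H] {I : ModelWithCorners ℝ E H}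
  {M : Type*} [TopologicalSpace M] [ChartedSpace H M]
  {F : Type*} [NormedAddCommGroup F] [NormedSpace ℝ F]

/-- The coordinate line through `x` with velocity `v`. -/
def coordLine (I : ModelWithCorners ℝ E H) (x : M) (v : E) (t : ℝ) : M :=
  (extChartAt I x).symm (extChartAt I x x + t • v)

theorem coordLine_zero (x : M) (v : E) : coordLine I x v 0 = x := by
  simp [coordLine]

theorem MDifferentiableAt.hasFDerivAt_comp_extChartAt_symm [I.Boundaryless] {f : M → F} {x : M}
    (hf : MDifferentiableAt I 𝓘(ℝ, F) f x) :
    HasFDerivAt (fun y : E => f ((extChartAt I x).symm y)) (mvfderiv I f x : E →L[ℝ] F)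
      (extChartAt I x x) := by
  have h := hf.hasMFDerivAt.2
  rw [I.range_eq_univ] at h
  exact HasFDerivWithinAt.hasFDerivAt (E := E) (F := F) h Filter.univ_mem

theorem MDifferentiableAt.hasDerivAt_coordLine_aux [I.Boundaryless] {f : M → F} {x : M}
    (hf : MDifferentiableAt I 𝓘(ℝ, F) f x) (v : E) :
    HasDerivAt (fun t => f (coordLine I x v t)) ((mvfderiv I f x : E →L[ℝ] F) v) 0 := by
  have h := hf.hasFDerivAt_comp_extChartAt_symm
  have hl : HasDerivAt (fun t : ℝ => extChartAt I x x + t • v) v 0 := by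
    simpa using ((hasDerivAt_id (0 : ℝ)).smul_const v).const_add (extChartAt I x x)
  have h0 : extChartAt I x x = extChartAt I x x + (0 : ℝ) • v := by simp
  rw [h0] at h
  exact h.comp_hasDerivAt (0 : ℝ) hl

/-- Derivatives on the manifold become derivatives of curves at `0`, so that product rules can be
applied in the ambient vector space. -/
theorem MDifferentiableAt.hasDerivAt_coordLine [I.Boundaryless] {f : M → F} {x : M}
    (hf : MDifferentiableAt I 𝓘(ℝ, F) f x) (v : TangentSpace I x) :
    HasDerivAt (fun t => f (coordLine I x v t)) (mvfderiv I f x v) 0 :=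
  hf.hasDerivAt_coordLine_aux v

theorem mvfderiv_eq_of_hasDerivAt [I.Boundaryless] {f : M → F} {x : M} {v : TangentSpace I x} {d : F}
    (hf : MDifferentiableAt I 𝓘(ℝ, F) f x)
    (h : HasDerivAt (fun t => f (coordLine I x v t)) d 0) : mvfderiv I f x v = d :=
  (hf.hasDerivAt_coordLine v).unique h

variable [IsManifold I ∞ M]

theorem IsSmoothVectorField.contMDiff_mvfderiv {f : M → F}
    (hf : ContMDiff I 𝓘(ℝ, F) ∞ f) {X : (x : M) → TangentSpace I x}
    (hX : IsSmoothVectorField X) : ContMDiff I 𝓘(ℝ, F) ∞ (fun y => mvfderiv I f y (X y)) := by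
  have h1 : ContMDiff I.tangent 𝓘(ℝ, F).tangent ∞ (tangentMap I 𝓘(ℝ, F) f) :=
    hf.contMDiff_tangentMap (by simp)
  have h2 := h1.comp hX
  have h3 := (contMDiff_snd_tangentBundle_modelSpace F 𝓘(ℝ, F) (n := ∞)).comp h2
  exact h3

theorem IsSmoothVectorField.mdifferentiableAt {X : (x : M) → TangentSpace I x}
    (hX : IsSmoothVectorField X) (x : M) :
    MDifferentiableAt I I.tangent (fun x => (⟨x, X x⟩ : TangentBundle I M)) x :=
  ContMDiffAt.mdifferentiableAt (hX x) (by simp)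

/-- A vector field read in the chart at `x`. -/
def chartField (I : ModelWithCorners ℝ E H) (x : M) (X : (x : M) → TangentSpace I x) : E → E :=
  mpullbackWithin 𝓘(ℝ, E) I (extChartAt I x).symm X (Set.range I)

/-- Chain rule: the pullback applies the inverse of the derivative of the inverse chart, which
cancels against that derivative. -/
theorem fderiv_comp_extChartAt_symm_mpullback [I.Boundaryless] {f : M → F}
    (hf : MDifferentiable I 𝓘(ℝ, F) f) (X : (x : M) → TangentSpace I x) (x : M) {y : E}
    (hy : y ∈ (extChartAt I x).target) :
    mvfderiv I f ((extChartAt I x).symm y) (X ((extChartAt I x).symm y)) =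
      fderiv ℝ (fun y : E => f ((extChartAt I x).symm y)) y
        (chartField I x X y) := by
  have hs : MDifferentiableAt 𝓘(ℝ, E) I (extChartAt I x).symm y := by
    have := mdifferentiableWithinAt_extChartAt_symm (I := I) hy
    rwa [I.range_eq_univ, mdifferentiableWithinAt_univ] at this
  have hc : mfderiv 𝓘(ℝ, E) 𝓘(ℝ, F) (f ∘ (extChartAt I x).symm) y =
      (mfderiv I 𝓘(ℝ, F) f ((extChartAt I x).symm y)).comp
        (mfderiv 𝓘(ℝ, E) I (extChartAt I x).symm y) := mfderiv_comp y (hf _) hs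
  have hi := isInvertible_mfderivWithin_extChartAt_symm (I := I) hy
  rw [mfderiv_eq_fderiv] at hc
  rw [chartField, mpullbackWithin_apply]
  rw [I.range_eq_univ, mfderivWithin_univ] at hi ⊢
  have h2 := congrArg (fun L => L ((mfderiv 𝓘(ℝ, E) I (extChartAt I x).symm y).inverse
    (X ((extChartAt I x).symm y)))) hc
  refine Eq.trans ?_ h2.symm
  change _ = (mfderiv I 𝓘(ℝ, F) f ((extChartAt I x).symm y))
    ((mfderiv 𝓘(ℝ, E) I (extChartAt I x).symm y) _)
  rw [hi.self_apply_inverse]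
  rfl

/-- The Lie bracket is the commutator of the directional derivatives. -/
theorem mvfderiv_mlieBracket [I.Boundaryless] [CompleteSpace E] {f : M → F}
    (hf : ContMDiff I 𝓘(ℝ, F) ∞ f) {X Y : (x : M) → TangentSpace I x}
    (hX : IsSmoothVectorField X) (hY : IsSmoothVectorField Y) (x : M) :
    mvfderiv I f x (mlieBracket I X Y x) =
      mvfderiv I (fun y => mvfderiv I f y (Y y)) x (X x)
        - mvfderiv I (fun y => mvfderiv I f y (X y)) x (Y x) := by
  set y₀ := extChartAt I x x with hy₀
  set G : E → F := fun y => f ((extChartAt I x).symm y) with hG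
  have hxs : (extChartAt I x).symm y₀ = x := by simp [hy₀]
  have hmem : y₀ ∈ (extChartAt I x).target := mem_extChartAt_target x
  have htarget : (extChartAt I x).target ∈ 𝓝 y₀ :=
    (isOpen_extChartAt_target x).mem_nhds hmem
  have hGs : ContDiffAt ℝ ∞ G y₀ := by
    have h : ContMDiffAt 𝓘(ℝ, E) 𝓘(ℝ, F) ∞ (f ∘ (extChartAt I x).symm) y₀ :=
      (hf _).comp y₀ ((contMDiffOn_extChartAt_symm x).contMDiffAt htarget)
    exact contMDiffAt_iff_contDiffAt.1 h
  have hfd : MDifferentiable I 𝓘(ℝ, F) f := hf.mdifferentiable (by simp)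
  -- In the chart, `Z (W f)` is a Hessian term plus the derivative of `W` along `Z`; the Hessian
  -- terms cancel in the commutator by symmetry.
  have key : ∀ Z W : (x : M) → TangentSpace I x, IsSmoothVectorField Z → IsSmoothVectorField W →
      DifferentiableAt ℝ
        (chartField I x W) y₀ ∧
      mvfderiv I (fun y => mvfderiv I f y (W y)) x (Z x) =
        fderiv ℝ (fderiv ℝ G) y₀
          (chartField I x Z y₀)
          (chartField I x W y₀)
        + fderiv ℝ G y₀
          (fderiv ℝ (chartField I x W) y₀
            (chartField I x Z y₀)) := by
    intro Z W hZ hW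
    have hd : DifferentiableAt ℝ
        (chartField I x W) y₀ := by
      have h := (hW.mdifferentiableAt x).mdifferentiableWithinAt (s := Set.univ)
      have h := h.differentiableWithinAt_mpullbackWithin_vectorField
      rw [Set.preimage_univ, Set.univ_inter] at h
      nth_rewrite 2 [I.range_eq_univ] at h
      exact DifferentiableWithinAt.differentiableAt h Filter.univ_mem
    refine ⟨hd, ?_⟩
    have hg : MDifferentiable I 𝓘(ℝ, F) (fun y => mvfderiv I f y (W y)) :=
      (hW.contMDiff_mvfderiv hf).mdifferentiable (by simp)
    have h1 := fderiv_comp_extChartAt_symm_mpullback hg Z x hmem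
    have h2 : (fun y : E => mvfderiv I f ((extChartAt I x).symm y) (W ((extChartAt I x).symm y)))
        =ᶠ[𝓝 y₀] fun y => fderiv ℝ G y
          (chartField I x W y) := by
      filter_upwards [htarget] with y hy
      exact fderiv_comp_extChartAt_symm_mpullback hfd W x hy
    have hGd : DifferentiableAt ℝ (fderiv ℝ G) y₀ :=
      (hGs.fderiv_right (m := 1) (by norm_cast)).differentiableAt (by simp)
    rw [h2.fderiv_eq, fderiv_clm_apply hGd hd] at h1
    have h3 : mvfderiv I (fun y => mvfderiv I f y (W y)) x (Z x) =
        mvfderiv I (fun y => mvfderiv I f y (W y)) ((extChartAt I x).symm y₀)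
          (Z ((extChartAt I x).symm y₀)) := by rw [hxs]
    rw [h3, h1, add_comm]
    rfl
  -- The bracket is the chart bracket carried back by the inverse derivative of the chart; writing
  -- `f` near `x` as `G` after the chart removes this inverse.
  have hb : mvfderiv I f x (mlieBracket I X Y x) = fderiv ℝ G y₀
      (fderiv ℝ (chartField I x Y) y₀
            (chartField I x X y₀)
        - fderiv ℝ (chartField I x X) y₀
            (chartField I x Y y₀)) := by
    rw [← mlieBracketWithin_univ, mlieBracketWithin_apply, Set.preimage_univ, Set.univ_inter]
    have hr : ∀ V W : E → E, lieBracketWithin ℝ V W (Set.range I) y₀ =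
        fderiv ℝ W y₀ (V y₀) - fderiv ℝ V y₀ (W y₀) := by
      intro V W
      rw [I.range_eq_univ, lieBracketWithin_univ]
      rfl
    have hφ : MDifferentiableAt I 𝓘(ℝ, E) (extChartAt I x) x :=
      mdifferentiableAt_extChartAt (mem_chart_source H x)
    have hi : (mfderiv I 𝓘(ℝ, E) (extChartAt I x) x).IsInvertible :=
      isInvertible_mfderiv_extChartAt (mem_extChartAt_source x)
    have hGd : MDifferentiableAt 𝓘(ℝ, E) 𝓘(ℝ, F) G (extChartAt I x x) :=
      (hGs.differentiableAt (by simp)).mdifferentiableAt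
    have hfG : f =ᶠ[𝓝 x] G ∘ extChartAt I x := by
      filter_upwards [extChartAt_source_mem_nhds (I := I) x] with y hy
      simp only [hG, Function.comp_apply]
      rw [(extChartAt I x).left_inv hy]
    have hc := mfderiv_comp x hGd hφ
    rw [mfderiv_eq_fderiv] at hc
    have hv : ∀ u : E, mfderiv I 𝓘(ℝ, F) f x ((mfderiv I 𝓘(ℝ, E) (extChartAt I x) x).inverse u) =
        fderiv ℝ G y₀ u := by
      intro u
      rw [hfG.mfderiv_eq, hc]
      exact congrArg (fderiv ℝ G y₀) (hi.self_apply_inverse u)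
    exact (hv _).trans (congrArg _ (hr (chartField I x X) (chartField I x Y)))
  have hsymm : IsSymmSndFDerivAt ℝ G y₀ := hGs.isSymmSndFDerivAt (by simp; norm_cast)
  rw [hb, (key X Y hX hY).2, (key Y X hY hX).2, map_sub,
    hsymm (chartField I x X y₀)]
  abel

/-- A local smooth extension is multiplied by a bump function supported where it is smooth. This
passes from identities between smooth fields to identities at a point. -/
theorem exists_isSmoothVectorField [FiniteDimensional ℝ E] [T2Space M] {x : M}
    (v : TangentSpace I x) : ∃ X : (x : M) → TangentSpace I x, IsSmoothVectorField X ∧ X x = v := by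
  obtain ⟨s, hs, h⟩ := FiberBundle.exists_contMDiffOn_extend (k := ∞) I E v
  obtain ⟨f, -, hf⟩ := ((SmoothBumpFunction.nhds_basis_tsupport (I := I) x).mem_iff).1
    (interior_mem_nhds.2 hs)
  refine ⟨fun y => f y • FiberBundle.extend E v y, fun y => ?_, by simp⟩
  by_cases hy : y ∈ tsupport f
  · exact ContMDiffAt.smul_section f.contMDiffAt (h.contMDiffAt (mem_interior_iff_mem_nhds.1 (hf hy)))
  · have h0 : (fun y => (⟨y, f y • FiberBundle.extend E v y⟩ : TangentBundle I M)) =ᶠ[𝓝 y]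
        Bundle.zeroSection E (TangentSpace I) := by
      filter_upwards [notMem_tsupport_iff_eventuallyEq.1 hy] with z hz
      simp [hz, Bundle.zeroSection]
    exact (Bundle.contMDiff_zeroSection ℝ (TangentSpace I : M → Type _) y).congr_of_eventuallyEq h0

theorem CovariantDerivative.isSmoothVectorField
    {D : CovariantDerivative I E (TangentSpace I : M → Type _)}
    (hD : D.ContMDiffCovariantDerivative ∞)
    {X Y : (x : M) → TangentSpace I x}
    (hX : IsSmoothVectorField X) (hY : IsSmoothVectorField Y) :
    IsSmoothVectorField (fun x => D Y x (X x)) := by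
  have hY' : ContMDiff I (I.prod 𝓘(ℝ, E)) (∞ + 1) (fun x => (⟨x, Y x⟩ : TangentBundle I M)) := hY
  have h := hD.contMDiff.contMDiff (σ := Y) (by simpa only [contMDiffOn_univ] using hY')
  rw [contMDiffOn_univ] at h
  intro x
  exact ContMDiffAt.clm_bundle_apply (h x) (hX x)

end Manifold

/-! ### Algebra of the metric and of the Christoffel form in the ambient space -/

namespace SphereProduct

section Algebra

variable {m : ℕ}

theorem fib_add_right (z v w : Cn m) : fib z (v + w) = fib z v + fib z w := by
  simp [fib]

theorem fib_swap (z v : Cn m) : fib z v = -fib v z := by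
  rw [fib, fib, ← inner_conj_symm, Complex.conj_im]

theorem re_inner_swap (z v : Cn m) : (inner ℂ z v).re = (inner ℂ v z).re := by
  rw [← inner_conj_symm, Complex.conj_re]

theorem inner_hor {z : Cn m} (hz : ‖z‖ = 1) (v : Cn m) : inner ℂ z (hor z v) = 0 := by
  simp [hor, hz]

/-- Tangency of `u` alone suffices: the omitted term is the product of the real parts of `⟨z, u⟩`
and `⟨z, v⟩`. -/
theorem re_inner_hor_hor {z : Cn m} (hz : ‖z‖ = 1) {u v : Cn m}
    (hu : (inner ℂ z u).re = 0) :
    (inner ℂ (hor z u) (hor z v)).re = (inner ℂ u v).re - fib z u * fib z v := by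
  have h : inner ℂ u z = (starRingEnd ℂ) (inner ℂ z u) := (inner_conj_symm _ _).symm
  simp [hor, hz, fib, h, hu, -inner_conj_symm]
  ring

theorem fib_smul_I_add {z h : Cn m} (hz : ‖z‖ = 1) (hh : inner ℂ z h = 0) (r : ℝ) :
    fib z ((r : ℂ) • Complex.I • z + Complex.I • h) = r := by
  simp [fib, hz, hh]

theorem hor_smul_I_add {z h : Cn m} (hz : ‖z‖ = 1) (hh : inner ℂ z h = 0) (r : ℝ) :
    hor z ((r : ℂ) • Complex.I • z + Complex.I • h) = Complex.I • h := by
  simp [hor, hz, hh, smul_smul]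

/-- The components of the Christoffel form of `g(a, c)` in the ambient space. The real numbers `s`
and `t` stand for the values on `u` and `v` of the linear form `vert₁` or `vert₂`. -/
def chrComp (z u v : Cn m) (s t : ℝ) : Cn m :=
  ((inner ℂ u v).re : ℂ) • z + ((t : ℂ) * Complex.I) • hor z u + ((s : ℂ) * Complex.I) • hor z v

theorem chrComp_swap (z u v : Cn m) (s t : ℝ) : chrComp z u v s t = chrComp z v u t s := by
  rw [chrComp, chrComp, re_inner_swap]
  abel

/-- The value is real, so the Christoffel form has no component along the fibres, only a horizontal
part and the normal part due to the sphere. -/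
theorem inner_chrComp {z : Cn m} (hz : ‖z‖ = 1) (u v : Cn m) (s t : ℝ) :
    inner ℂ z (chrComp z u v s t) = (inner ℂ u v).re := by
  simp [chrComp, inner_hor hz, hz]

theorem re_inner_chrComp {z u v w : Cn m} (hu : (inner ℂ z u).re = 0)
    (hv : (inner ℂ z v).re = 0) (hw : (inner ℂ z w).re = 0) (s t : ℝ) :
    (inner ℂ (chrComp z u v s t) w).re = t * fib u w + s * fib v w := by
  have h1 : inner ℂ u z = (starRingEnd ℂ) (inner ℂ z u) := (inner_conj_symm _ _).symm
  have h2 : inner ℂ v z = (starRingEnd ℂ) (inner ℂ z v) := (inner_conj_symm _ _).symm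
  simp [chrComp, hor, fib, hu, hv, hw, h1, h2, -inner_conj_symm]
  ring

end Algebra

variable {n p : ℕ}

/-- The first component of the difference of the vertical parts of `g(a, c)` and of the product of
the round metrics. -/
def vert₁ (a c : ℝ) (q v : Amb n p) : ℝ := (1 / c - 1) * fib q.1 v.1 - a / c * fib q.2 v.2

/-- The second component of the difference of the vertical parts of `g(a, c)` and of the product of
the round metrics. -/
def vert₂ (a c : ℝ) (q v : Amb n p) : ℝ :=
  -(a / c) * fib q.1 v.1 + ((a ^ 2 + c ^ 2) / c - 1) * fib q.2 v.2

/-- The metric `g(a, c)` as a polynomial in the ambient space. -/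
def gram (a c : ℝ) (q u v : Amb n p) : ℝ :=
  vert₁ a c q u * fib q.1 v.1 + vert₂ a c q u * fib q.2 v.2
    + (inner ℂ u.1 v.1).re + (inner ℂ u.2 v.2).re

/-- The Christoffel form of `g(a, c)` in the ambient space. -/
def chr (a c : ℝ) (q u v : Amb n p) : Amb n p :=
  (chrComp q.1 u.1 v.1 (vert₁ a c q u) (vert₁ a c q v),
    chrComp q.2 u.2 v.2 (vert₂ a c q u) (vert₂ a c q v))

/-- The points of the product of the unit spheres. -/
def IsUnit₂ (q : Amb n p) : Prop := ‖q.1‖ = 1 ∧ ‖q.2‖ = 1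

/-- The vectors tangent to the product of spheres. -/
def IsTangent (q v : Amb n p) : Prop := (inner ℂ q.1 v.1).re = 0 ∧ (inner ℂ q.2 v.2).re = 0

theorem chr_swap (a c : ℝ) (q u v : Amb n p) : chr a c q u v = chr a c q v u := by
  rw [chr, chr, chrComp_swap, chrComp_swap (q.2)]

theorem gram_swap (a c : ℝ) (q u v : Amb n p) : gram a c q u v = gram a c q v u := by
  simp only [gram, vert₁, vert₂, re_inner_swap u.1, re_inner_swap u.2]
  ring

theorem gram_add_left (a c : ℝ) (q u v w : Amb n p) :
    gram a c q (u + v) w = gram a c q u w + gram a c q v w := by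
  simp only [gram, vert₁, vert₂, Prod.fst_add, Prod.snd_add, fib_add_right, inner_add_left,
    Complex.add_re]
  ring

theorem gram_sub_left (a c : ℝ) (q u v w : Amb n p) :
    gram a c q (u - v) w = gram a c q u w - gram a c q v w := by
  rw [eq_sub_iff_add_eq, ← gram_add_left, sub_add_cancel]

/-- Completing the square in the two fibre coordinates `f₁`, `f₂` gives `(f₁ - a f₂)² / c + c f₂²`,
to which the horizontal norms are added. -/
theorem eq_zero_of_gram_self {a c : ℝ} (hc : 0 < c) {q u : Amb n p} (hq : IsUnit₂ q)
    (hu : IsTangent q u) (h : gram a c q u u = 0) : u = 0 := by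
  have h1 := re_inner_hor_hor hq.1 (v := u.1) hu.1
  have h2 := re_inner_hor_hor hq.2 (v := u.2) hu.2
  have e1 : 0 ≤ (inner ℂ (hor q.1 u.1) (hor q.1 u.1)).re := inner_self_nonneg (𝕜 := ℂ)
  have e2 : 0 ≤ (inner ℂ (hor q.2 u.2) (hor q.2 u.2)).re := inner_self_nonneg (𝕜 := ℂ)
  have hg : gram a c q u u = 1 / c * (fib q.1 u.1 - a * fib q.2 u.2) ^ 2 + c * fib q.2 u.2 ^ 2
      + (inner ℂ (hor q.1 u.1) (hor q.1 u.1)).re + (inner ℂ (hor q.2 u.2) (hor q.2 u.2)).re := by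
    rw [h1, h2]
    simp only [gram, vert₁, vert₂]
    field_simp
    ring
  have f1 : 0 ≤ 1 / c * (fib q.1 u.1 - a * fib q.2 u.2) ^ 2 := by positivity
  have f2 : 0 ≤ c * fib q.2 u.2 ^ 2 := by positivity
  rw [h] at hg
  have g2 : fib q.2 u.2 = 0 := by
    have : c * fib q.2 u.2 ^ 2 = 0 := by linarith
    simpa [hc.ne'] using this
  have g1 : fib q.1 u.1 = 0 := by
    have : 1 / c * (fib q.1 u.1 - a * fib q.2 u.2) ^ 2 = 0 := by linarith
    simpa [hc.ne', g2] using this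
  have k : ∀ {m : ℕ} {z v : Cn m}, (inner ℂ z v).re = 0 → fib z v = 0 →
      (inner ℂ (hor z v) (hor z v)).re = 0 → v = 0 := by
    intro m z v hr hi h0
    have hzv : inner ℂ z v = (0 : ℂ) := Complex.ext hr hi
    have : hor z v = v := by simp [hor, hzv]
    rw [this] at h0
    exact inner_self_eq_zero.1 (Complex.ext h0 (inner_self_im (𝕜 := ℂ) v))
  exact Prod.ext (k hu.1 g1 (by linarith)) (k hu.2 g2 (by linarith))

theorem vert₁_chr (a c : ℝ) {q : Amb n p} (hq : IsUnit₂ q) (u v : Amb n p) :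
    vert₁ a c q (chr a c q u v) = 0 := by
  simp [vert₁, chr, fib, inner_chrComp hq.1, inner_chrComp hq.2]

theorem vert₂_chr (a c : ℝ) {q : Amb n p} (hq : IsUnit₂ q) (u v : Amb n p) :
    vert₂ a c q (chr a c q u v) = 0 := by
  simp [vert₂, chr, fib, inner_chrComp hq.1, inner_chrComp hq.2]

theorem gram_chr_left (a c : ℝ) {q u v w : Amb n p} (hq : IsUnit₂ q) (hu : IsTangent q u)
    (hv : IsTangent q v) (hw : IsTangent q w) :
    gram a c q (chr a c q u v) w = vert₁ a c q v * fib u.1 w.1 + vert₁ a c q u * fib v.1 w.1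
      + (vert₂ a c q v * fib u.2 w.2 + vert₂ a c q u * fib v.2 w.2) := by
  rw [gram, vert₁_chr a c hq, vert₂_chr a c hq, chr, re_inner_chrComp hu.1 hv.1 hw.1,
    re_inner_chrComp hu.2 hv.2 hw.2]
  ring

/-- The Christoffel form is compatible with the metric. -/
theorem gram_chr_add_gram_chr (a c : ℝ) {q u v w : Amb n p} (hq : IsUnit₂ q) (hu : IsTangent q u)
    (hv : IsTangent q v) (hw : IsTangent q w) :
    gram a c q (chr a c q u v) w + gram a c q v (chr a c q u w) =
      vert₁ a c u v * fib q.1 w.1 + vert₁ a c q v * fib u.1 w.1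
        + (vert₂ a c u v * fib q.2 w.2 + vert₂ a c q v * fib u.2 w.2) := by
  -- The right-hand side is the derivative of `gram` in the base point along `u`. The terms with
  -- `vert` of `u` cancel since `fib v w` is antisymmetric; the rest agree because the coefficient
  -- matrix of `vert₁`, `vert₂` is symmetric.
  rw [gram_swap a c q v, gram_chr_left a c hq hu hv hw, gram_chr_left a c hq hu hw hv,
    fib_swap w.1, fib_swap w.2]
  simp only [vert₁, vert₂]
  ring

/-- On horizontal parts `Im⟨u, i v⟩ = Re⟨u, v⟩`; subtracting the round fibre terms from the vertical
block leaves the coefficients of `vert₁` and `vert₂`. -/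
theorem metric_eq_gram_of_isTangent (a c : ℝ) {q u v : Amb n p} (hq : IsUnit₂ q)
    (hu : IsTangent q u) :
    omega q u (cplx a c q v) = gram a c q u v := by
  have e1 := inner_hor hq.1 v.1
  have e2 := inner_hor hq.2 v.2
  have f1 : fib q.1 (cplx a c q v).1 = (a / c) * fib q.1 v.1 - ((a ^ 2 + c ^ 2) / c) * fib q.2 v.2 :=
    fib_smul_I_add hq.1 e1 _
  have f2 : fib q.2 (cplx a c q v).2 = (1 / c) * fib q.1 v.1 - (a / c) * fib q.2 v.2 :=
    fib_smul_I_add hq.2 e2 _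
  have g1 : hor q.1 (cplx a c q v).1 = Complex.I • hor q.1 v.1 := hor_smul_I_add hq.1 e1 _
  have g2 : hor q.2 (cplx a c q v).2 = Complex.I • hor q.2 v.2 := hor_smul_I_add hq.2 e2 _
  rw [omega, f1, f2, g1, g2]
  simp only [inner_smul_right, Complex.I_mul_im]
  rw [re_inner_hor_hor hq.1 hu.1, re_inner_hor_hor hq.2 hu.2]
  simp only [gram, vert₁, vert₂]
  ring

section Derivative

variable {m : ℕ}

theorem hasDerivAt_re {f : ℝ → ℂ} {f' : ℂ} {t : ℝ} (h : HasDerivAt f f' t) :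
    HasDerivAt (fun t => (f t).re) f'.re t :=
  Complex.reCLM.hasFDerivAt.comp_hasDerivAt t h

theorem hasDerivAt_im {f : ℝ → ℂ} {f' : ℂ} {t : ℝ} (h : HasDerivAt f f' t) :
    HasDerivAt (fun t => (f t).im) f'.im t :=
  Complex.imCLM.hasFDerivAt.comp_hasDerivAt t h

theorem hasDerivAt_fib {z v : ℝ → Cn m} {z' v' : Cn m} {t : ℝ} (hz : HasDerivAt z z' t)
    (hv : HasDerivAt v v' t) :
    HasDerivAt (fun t => fib (z t) (v t)) (fib (z t) v' + fib z' (v t)) t :=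
  hasDerivAt_im (hz.inner ℂ hv)

theorem hasDerivAt_hor {z v : ℝ → Cn m} {z' v' : Cn m} {t : ℝ} (hz : HasDerivAt z z' t)
    (hv : HasDerivAt v v' t) :
    HasDerivAt (fun t => hor (z t) (v t))
      (hor (z t) v' - ((inner ℂ (z t) (v t) : ℂ) • z' + (inner ℂ z' (v t) : ℂ) • z t)) t := by
  refine (hv.sub ((hz.inner ℂ hv).smul hz)).congr_deriv ?_
  simp only [hor]
  module

theorem hasDerivAt_chrComp {z u v : ℝ → Cn m} {z' u' v' : Cn m} {s r : ℝ → ℝ} {s' r' t : ℝ}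
    (hz : HasDerivAt z z' t) (hu : HasDerivAt u u' t) (hv : HasDerivAt v v' t)
    (hs : HasDerivAt s s' t) (hr : HasDerivAt r r' t) :
    HasDerivAt (fun t => chrComp (z t) (u t) (v t) (s t) (r t))
      (((inner ℂ (u t) v' + inner ℂ u' (v t)).re : ℂ) • z t + ((inner ℂ (u t) (v t)).re : ℂ) • z'
        + ((r t : ℂ) * Complex.I) • (hor (z t) u'
          - ((inner ℂ (z t) (u t) : ℂ) • z' + (inner ℂ z' (u t) : ℂ) • z t))
        + ((r' : ℂ) * Complex.I) • hor (z t) (u t)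
        + ((s t : ℂ) * Complex.I) • (hor (z t) v'
          - ((inner ℂ (z t) (v t) : ℂ) • z' + (inner ℂ z' (v t) : ℂ) • z t))
        + ((s' : ℂ) * Complex.I) • hor (z t) (v t)) t := by
  have h1 := (hasDerivAt_re (hu.inner ℂ hv)).ofReal_comp.smul hz
  have h2 := (hr.ofReal_comp.mul_const Complex.I).smul (hasDerivAt_hor hz hu)
  have h3 := (hs.ofReal_comp.mul_const Complex.I).smul (hasDerivAt_hor hz hv)
  refine ((h1.add h2).add h3).congr_deriv ?_
  abel

end Derivative

end SphereProduct

/-! ### The embedding of the product of spheres and its tangent spaces -/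

namespace SphereProduct

variable {n p : ℕ}

theorem contMDiff_incl :
    ContMDiff (Mdl n p) 𝓘(ℝ, Amb n p) ∞ (incl : Mfd n p → Amb n p) := by
  have h1 : ContMDiff (Mdl n p) 𝓘(ℝ, Cn n) ∞ (fun q : Mfd n p => (q.1 : Cn n)) :=
    contMDiff_coe_sphere.comp contMDiff_fst
  have h2 : ContMDiff (Mdl n p) 𝓘(ℝ, Cn p) ∞ (fun q : Mfd n p => (q.2 : Cn p)) :=
    contMDiff_coe_sphere.comp contMDiff_snd
  exact h1.prodMk_space h2

theorem mdifferentiable_incl :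
    MDifferentiable (Mdl n p) 𝓘(ℝ, Amb n p) (incl : Mfd n p → Amb n p) :=
  contMDiff_incl.mdifferentiable (by simp)

theorem isUnit₂_incl (q : Mfd n p) : IsUnit₂ (incl q) := by
  simp [IsUnit₂, incl]

/-- A vector field on the product of spheres as a function with values in the ambient space. -/
def hat (X : (q : Mfd n p) → TangentSpace (Mdl n p) q) (q : Mfd n p) : Amb n p :=
  ambient q (X q)

theorem contMDiff_hat {X : (q : Mfd n p) → TangentSpace (Mdl n p) q}
    (hX : IsSmoothVectorField X) : ContMDiff (Mdl n p) 𝓘(ℝ, Amb n p) ∞ (hat X) :=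
  hX.contMDiff_mvfderiv contMDiff_incl

theorem hasDerivAt_incl (q : Mfd n p) (v : TangentSpace (Mdl n p) q) :
    HasDerivAt (fun t => incl (coordLine (Mdl n p) q v t)) (ambient q v) 0 :=
  (mdifferentiable_incl q).hasDerivAt_coordLine v

theorem hasDerivAt_hat {X : (q : Mfd n p) → TangentSpace (Mdl n p) q}
    (hX : IsSmoothVectorField X) (q : Mfd n p) (v : TangentSpace (Mdl n p) q) :
    HasDerivAt (fun t => hat X (coordLine (Mdl n p) q v t)) (mvfderiv (Mdl n p) (hat X) q v) 0 :=
  ((contMDiff_hat hX).mdifferentiable (by simp) q).hasDerivAt_coordLine v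

theorem isTangent_ambient (q : Mfd n p) (v : TangentSpace (Mdl n p) q) :
    IsTangent (incl q) (ambient q v) := by
  have h := hasDerivAt_incl q v
  have key : ∀ {m : ℕ} {z : ℝ → Cn m} {z' : Cn m}, HasDerivAt z z' 0 → (∀ t, ‖z t‖ = 1) →
      (inner ℂ (z 0) z').re = 0 := by
    intro m z z' hz h1
    have h2 := hasDerivAt_re (hz.inner ℂ hz)
    have h3 : (fun t => (inner ℂ (z t) (z t) : ℂ).re) = fun _ => 1 := by
      funext t
      rw [inner_self_eq_norm_sq_to_K, h1]
      simp
    rw [h3] at h2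
    have h4 := h2.unique (hasDerivAt_const (0 : ℝ) (1 : ℝ))
    rw [Complex.add_re, re_inner_swap z'] at h4
    linarith
  have h1 := key h.fst (fun t => (isUnit₂_incl _).1)
  have h2 := key h.snd (fun t => (isUnit₂_incl _).2)
  have e : coordLine (Mdl n p) q v 0 = q :=
    coordLine_zero (E := Model n p) q v
  rw [e] at h1 h2
  exact ⟨h1, h2⟩

theorem real_inner_eq_re {m : ℕ} (z v : Cn m) : inner ℝ z v = (inner ℂ z v).re := by
  simp [PiLp.inner_apply]

/-- The derivative of the inclusion of each sphere has the real orthogonal complement of `z` as its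
range. -/
theorem exists_ambient_eq {q : Mfd n p} {w : Amb n p} (hw : IsTangent (incl q) w) :
    ∃ v : TangentSpace (Mdl n p) q, ambient q v = w := by
  have k : ∀ {m : ℕ} (z : Sph m) (u : Cn m), (inner ℂ (z : Cn m) u).re = 0 →
      ∃ v : TangentSpace (𝓡 (2 * m + 1)) z,
        mvfderiv (𝓡 (2 * m + 1)) ((↑) : Sph m → Cn m) z v = u := by
    intro m z u hu
    have hr := range_mvfderiv_subtypeVal (n := 2 * m + 1) z
    have hm : u ∈ (Submodule.span ℝ {(z : Cn m)})ᗮ := by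
      rw [Submodule.mem_orthogonal_singleton_iff_inner_right, real_inner_eq_re]
      exact hu
    rw [← hr] at hm
    exact hm
  obtain ⟨v1, h1⟩ := k q.1 w.1 hw.1
  obtain ⟨v2, h2⟩ := k q.2 w.2 hw.2
  refine ⟨(v1, v2), ?_⟩
  have d1 := ((contMDiff_coe_sphere (m := 1) (n := 2 * n + 1)).mdifferentiable (by simp)
    q.1).hasDerivAt_coordLine v1
  have d2 := ((contMDiff_coe_sphere (m := 1) (n := 2 * p + 1)).mdifferentiable (by simp)
    q.2).hasDerivAt_coordLine v2
  rw [h1] at d1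
  rw [h2] at d2
  refine mvfderiv_eq_of_hasDerivAt (mdifferentiable_incl q) ((d1.prodMk d2).congr_deriv ?_)
  rfl

theorem isSmoothVectorField_cov
    {D : CovariantDerivative (Mdl n p) (Model n p) (TangentSpace (Mdl n p) : Mfd n p → Type _)}
    {a c : ℝ} (hD : IsLeviCivita D (metric a c)) {X Y : (q : Mfd n p) → TangentSpace (Mdl n p) q}
    (hX : IsSmoothVectorField X) (hY : IsSmoothVectorField Y) :
    IsSmoothVectorField (fun x => D Y x (X x)) :=
  CovariantDerivative.isSmoothVectorField hD.smooth hX hY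

theorem metric_eq_gram (a c : ℝ) (q : Mfd n p) (u v : TangentSpace (Mdl n p) q) :
    metric a c q u v = gram a c (incl q) (ambient q u) (ambient q v) :=
  metric_eq_gram_of_isTangent a c (isUnit₂_incl q) (isTangent_ambient q u)

end SphereProduct

/-! ### Identification of the Levi-Civita connection -/

namespace SphereProduct

variable {n p : ℕ} {a c : ℝ}

section Differentiable

variable {V : Type*} [NormedAddCommGroup V] [NormedSpace ℝ V]

theorem differentiable_re_inner {m : ℕ} {f g : V → Cn m} (hf : Differentiable ℝ f)
    (hg : Differentiable ℝ g) : Differentiable ℝ (fun w => (inner ℂ (f w) (g w)).re) :=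
  Complex.reCLM.differentiable.comp (hf.inner ℂ hg)

theorem differentiable_fib {m : ℕ} {f g : V → Cn m} (hf : Differentiable ℝ f)
    (hg : Differentiable ℝ g) : Differentiable ℝ (fun w => fib (f w) (g w)) :=
  Complex.imCLM.differentiable.comp (hf.inner ℂ hg)

theorem differentiable_gram {q u v : V → Amb n p} (hq : Differentiable ℝ q)
    (hu : Differentiable ℝ u) (hv : Differentiable ℝ v) :
    Differentiable ℝ (fun w => gram a c (q w) (u w) (v w)) := by
  have k {f g : V → Amb n p} (hf : Differentiable ℝ f) (hg : Differentiable ℝ g) :=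
    differentiable_fib hf.fst hg.fst
  have l {f g : V → Amb n p} (hf : Differentiable ℝ f) (hg : Differentiable ℝ g) :=
    differentiable_fib hf.snd hg.snd
  exact (((((k hq hu).const_mul _).sub ((l hq hu).const_mul _)).mul (k hq hv)).add
    ((((k hq hu).const_mul _).add ((l hq hu).const_mul _)).mul (l hq hv))).add
    (differentiable_re_inner hu.fst hv.fst) |>.add (differentiable_re_inner hu.snd hv.snd)

theorem _root_.Differentiable.mdifferentiable_comp {E H M W : Type*} [NormedAddCommGroup E]
    [NormedSpace ℝ E] [TopologicalSpace H] {I : ModelWithCorners ℝ E H} [TopologicalSpace M]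
    [ChartedSpace H M] [NormedAddCommGroup W] [NormedSpace ℝ W] {G : V → W} {f : M → V}
    (hG : Differentiable ℝ G) (hf : ContMDiff I 𝓘(ℝ, V) ∞ f) :
    MDifferentiable I 𝓘(ℝ, W) (fun q => G (f q)) :=
  hG.mdifferentiable.comp (hf.mdifferentiable (by simp))

end Differentiable

theorem mdifferentiable_gram {X Y : (q : Mfd n p) → TangentSpace (Mdl n p) q}
    (hX : IsSmoothVectorField X) (hY : IsSmoothVectorField Y) :
    MDifferentiable (Mdl n p) 𝓘(ℝ, ℝ) (fun q => gram a c (incl q) (hat X q) (hat Y q)) := by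
  have hG : Differentiable ℝ (fun w : Amb n p × Amb n p × Amb n p => gram a c w.1 w.2.1 w.2.2) :=
    differentiable_gram differentiable_fst differentiable_snd.fst differentiable_snd.snd
  have h1 := (contMDiff_hat hX).prodMk_space (contMDiff_hat hY)
  have h2 := contMDiff_incl.prodMk_space h1
  have h3 := hG.mdifferentiable_comp h2
  beta_reduce at h3
  exact h3

section Curve

variable {q u v : ℝ → Amb n p} {q' u' v' : Amb n p} {t : ℝ}

theorem hasDerivAt_fst (hq : HasDerivAt q q' t) : HasDerivAt (fun t => (q t).1) q'.1 t :=
  (ContinuousLinearMap.fst ℝ (Cn n) (Cn p)).hasFDerivAt.comp_hasDerivAt t hq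

theorem hasDerivAt_snd (hq : HasDerivAt q q' t) : HasDerivAt (fun t => (q t).2) q'.2 t :=
  (ContinuousLinearMap.snd ℝ (Cn n) (Cn p)).hasFDerivAt.comp_hasDerivAt t hq

theorem hasDerivAt_vert₁ (hq : HasDerivAt q q' t) (hv : HasDerivAt v v' t) :
    HasDerivAt (fun t => vert₁ a c (q t) (v t)) (vert₁ a c (q t) v' + vert₁ a c q' (v t)) t := by
  refine (((hasDerivAt_fib (hasDerivAt_fst hq) (hasDerivAt_fst hv)).const_mul _).sub
    ((hasDerivAt_fib (hasDerivAt_snd hq) (hasDerivAt_snd hv)).const_mul _)).congr_deriv ?_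
  simp only [vert₁]
  ring

theorem hasDerivAt_vert₂ (hq : HasDerivAt q q' t) (hv : HasDerivAt v v' t) :
    HasDerivAt (fun t => vert₂ a c (q t) (v t)) (vert₂ a c (q t) v' + vert₂ a c q' (v t)) t := by
  refine (((hasDerivAt_fib (hasDerivAt_fst hq) (hasDerivAt_fst hv)).const_mul _).add
    ((hasDerivAt_fib (hasDerivAt_snd hq) (hasDerivAt_snd hv)).const_mul _)).congr_deriv ?_
  simp only [vert₂]
  ring

theorem hasDerivAt_gram (hq : HasDerivAt q q' t) (hu : HasDerivAt u u' t)
    (hv : HasDerivAt v v' t) :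
    HasDerivAt (fun t => gram a c (q t) (u t) (v t))
      (gram a c (q t) u' (v t) + gram a c (q t) (u t) v'
        + (vert₁ a c q' (u t) * fib (q t).1 (v t).1 + vert₁ a c (q t) (u t) * fib q'.1 (v t).1
        + (vert₂ a c q' (u t) * fib (q t).2 (v t).2 + vert₂ a c (q t) (u t) * fib q'.2 (v t).2)))
      t := by
  refine (((((hasDerivAt_vert₁ hq hu).mul (hasDerivAt_fib (hasDerivAt_fst hq) (hasDerivAt_fst hv))).add
    ((hasDerivAt_vert₂ hq hu).mul (hasDerivAt_fib (hasDerivAt_snd hq) (hasDerivAt_snd hv)))).add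
    (hasDerivAt_re ((hasDerivAt_fst hu).inner ℂ (hasDerivAt_fst hv)))).add
    (hasDerivAt_re ((hasDerivAt_snd hu).inner ℂ (hasDerivAt_snd hv)))).congr_deriv ?_
  simp only [gram, Complex.add_re]
  ring

end Curve

variable {D : CovariantDerivative (Mdl n p) (Model n p) (TangentSpace (Mdl n p) : Mfd n p → Type _)}

/-- The difference of the connection `D` and of the connection with Christoffel form `chr`. -/
def defect (D : CovariantDerivative (Mdl n p) (Model n p) (TangentSpace (Mdl n p) : Mfd n p → Type _))
    (a c : ℝ) (X Y : (q : Mfd n p) → TangentSpace (Mdl n p) q) (q : Mfd n p) : Amb n p :=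
  ambient q (D Y q (X q))
    - (mvfderiv (Mdl n p) (hat Y) q (X q) + chr a c (incl q) (hat X q) (hat Y q))

variable {X Y Z : (q : Mfd n p) → TangentSpace (Mdl n p) q}

/-- Torsion-freeness, with the bracket applied to the inclusion, says that `D_X Y - D_Y X` is the
antisymmetrized flat derivative; `chr` is symmetric. -/
theorem defect_swap (hD : IsLeviCivita D (metric a c)) (hX : IsSmoothVectorField X)
    (hY : IsSmoothVectorField Y) (q : Mfd n p) : defect D a c X Y q = defect D a c Y X q := by
  have h1 := D.torsion_eq_zero_iff.1 hD.torsion_free (hX.mdifferentiableAt q)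
    (hY.mdifferentiableAt q)
  have h2 := mvfderiv_mlieBracket contMDiff_incl hX hY q
  rw [← h1, map_sub] at h2
  have h3 : ambient q (D Y q (X q)) - ambient q (D X q (Y q)) =
    mvfderiv (Mdl n p) (hat Y) q (X q) - mvfderiv (Mdl n p) (hat X) q (Y q) := h2
  rw [defect, defect, chr_swap]
  rw [sub_eq_sub_iff_add_eq_add] at h3 ⊢
  rw [← add_assoc, h3]
  abel

/-- The derivative of `g(Y, Z)` along `X` is computed twice: by compatibility of `D`, and by the
product rule together with compatibility of `chr`. -/
theorem gram_defect_add (hD : IsLeviCivita D (metric a c)) (hX : IsSmoothVectorField X)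
    (hY : IsSmoothVectorField Y) (hZ : IsSmoothVectorField Z) (q : Mfd n p) :
    gram a c (incl q) (defect D a c X Y q) (hat Z q)
      + gram a c (incl q) (hat Y q) (defect D a c X Z q) = 0 := by
  have h1 := hD.compatible X Y Z hX hY hZ q
  have e : coordLine (Mdl n p) q (X q) 0 = q := coordLine_zero (E := Model n p) q (X q)
  have h2 := hasDerivAt_gram (a := a) (c := c) (hasDerivAt_incl q (X q)) (hasDerivAt_hat hY q (X q))
    (hasDerivAt_hat hZ q (X q))
  have h3 := mvfderiv_eq_of_hasDerivAt (mdifferentiable_gram hY hZ q) h2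
  have h4 : (fun y => metric a c y (Y y) (Z y)) =
      fun q => gram a c (incl q) (hat Y q) (hat Z q) := by
    funext y
    exact metric_eq_gram a c y _ _
  rw [h4, h3, e, metric_eq_gram, metric_eq_gram] at h1
  have h5 := gram_chr_add_gram_chr a c (isUnit₂_incl q) (isTangent_ambient q (X q))
    (isTangent_ambient q (Y q)) (isTangent_ambient q (Z q))
  simp only [defect, gram_sub_left, gram_add_left, gram_swap a c (incl q) (hat Y q)]
  simp only [hat] at h1 ⊢
  rw [gram_swap a c (incl q) (ambient q (Y q)) (chr _ _ _ _ _)] at h5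
  rw [gram_swap a c (incl q) (ambient q (Y q)) (mvfderiv _ _ _ _),
    gram_swap a c (incl q) (ambient q (Y q)) (ambient _ _)] at h1
  linarith

/-- The Koszul argument: a trilinear expression symmetric in one pair of arguments and skew in
another is zero, by combining three cyclic instances. -/
theorem gram_defect (hD : IsLeviCivita D (metric a c)) (hX : IsSmoothVectorField X)
    (hY : IsSmoothVectorField Y) (hZ : IsSmoothVectorField Z) (q : Mfd n p) :
    gram a c (incl q) (defect D a c X Y q) (hat Z q) = 0 := by
  have h1 := gram_defect_add hD hX hY hZ q
  have h2 := gram_defect_add hD hY hZ hX q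
  have h3 := gram_defect_add hD hZ hX hY q
  rw [gram_swap a c (incl q) (hat _ q)] at h1 h2 h3
  rw [defect_swap hD hX hZ] at h1
  rw [defect_swap hD hY hX] at h2
  rw [defect_swap hD hZ hY] at h3
  linarith

/-- Differentiating `Re⟨q, Y⟩ = 0` in each factor gives the flat derivative the normal part `-Re⟨X,
Y⟩`, which the normal part of `chr` cancels. -/
theorem isTangent_defect (hY : IsSmoothVectorField Y) (q : Mfd n p) :
    IsTangent (incl q) (defect D a c X Y q) := by
  have h0 := isTangent_ambient q (D Y q (X q))
  have h1 := hasDerivAt_incl q (X q)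
  have h2 := hasDerivAt_hat hY q (X q)
  have ht := fun t => isTangent_ambient (coordLine (Mdl n p) q (X q) t) (Y _)
  have e : coordLine (Mdl n p) q (X q) 0 = q := coordLine_zero (E := Model n p) q (X q)
  have k1 := (hasDerivAt_re ((hasDerivAt_fst h1).inner ℂ (hasDerivAt_fst h2))).unique
    ((hasDerivAt_const (0 : ℝ) (0 : ℝ)).congr_of_eventuallyEq
      (Filter.Eventually.of_forall fun t => (ht t).1))
  have k2 := (hasDerivAt_re ((hasDerivAt_snd h1).inner ℂ (hasDerivAt_snd h2))).unique
    ((hasDerivAt_const (0 : ℝ) (0 : ℝ)).congr_of_eventuallyEq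
      (Filter.Eventually.of_forall fun t => (ht t).2))
  rw [e] at k1 k2
  have hu := isUnit₂_incl q
  constructor
  · simp only [defect, Prod.fst_sub, Prod.fst_add, inner_sub_right, inner_add_right, chr,
      inner_chrComp hu.1, Complex.sub_re, Complex.add_re, Complex.ofReal_re, h0.1] at k1 ⊢
    simp only [hat] at k1 ⊢
    linarith
  · simp only [defect, Prod.snd_sub, Prod.snd_add, inner_sub_right, inner_add_right, chr,
      inner_chrComp hu.2, Complex.sub_re, Complex.add_re, Complex.ofReal_re, h0.2] at k2 ⊢
    simp only [hat] at k2 ⊢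
    linarith

/-- The Levi-Civita connection of `g(a, c)` in the ambient space. -/
theorem ambient_cov (hc : 0 < c) (hD : IsLeviCivita D (metric a c)) (hX : IsSmoothVectorField X)
    (hY : IsSmoothVectorField Y) (q : Mfd n p) :
    ambient q (D Y q (X q)) =
      mvfderiv (Mdl n p) (hat Y) q (X q) + chr a c (incl q) (hat X q) (hat Y q) := by
  have ht : IsTangent (incl q) (defect D a c X Y q) := isTangent_defect hY q
  obtain ⟨v, hv⟩ := exists_ambient_eq ht
  -- `Z` takes the value of the defect at `q`, so the defect is orthogonal to itself.
  obtain ⟨Z, hZ, rfl⟩ := exists_isSmoothVectorField v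
  have h := gram_defect hD hX hY hZ q
  rw [hat, hv] at h
  exact sub_eq_zero.1 (eq_zero_of_gram_self hc (isUnit₂_incl q) ht h)

end SphereProduct

/-! ### The curvature as an algebraic expression in the Christoffel form -/

namespace SphereProduct

section Algebra

variable {m : ℕ}

/-- The derivative of `chrComp` with respect to the base point. -/
def chrCompD (z z' u v : Cn m) (s t s' t' : ℝ) : Cn m :=
  ((inner ℂ u v).re : ℂ) • z'
    - ((t : ℂ) * Complex.I) • ((inner ℂ z u : ℂ) • z' + (inner ℂ z' u : ℂ) • z)
    + ((t' : ℂ) * Complex.I) • hor z u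
    - ((s : ℂ) * Complex.I) • ((inner ℂ z v : ℂ) • z' + (inner ℂ z' v : ℂ) • z)
    + ((s' : ℂ) * Complex.I) • hor z v

theorem hor_add (z v w : Cn m) : hor z (v + w) = hor z v + hor z w := by
  simp only [hor, inner_add_right]
  module

theorem chrComp_add_left (z u u' v : Cn m) (s s' t : ℝ) :
    chrComp z (u + u') v (s + s') t = chrComp z u v s t + chrComp z u' v s' t := by
  simp only [chrComp, inner_add_left, hor_add, Complex.add_re, Complex.ofReal_add]
  module

end Algebra

variable {n p : ℕ} {a c : ℝ}

theorem chr_add_left (q u u' v : Amb n p) :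
    chr a c q (u + u') v = chr a c q u v + chr a c q u' v := by
  have h1 : vert₁ a c q (u + u') = vert₁ a c q u + vert₁ a c q u' := by
    simp only [vert₁, Prod.fst_add, Prod.snd_add, fib_add_right]
    ring
  have h2 : vert₂ a c q (u + u') = vert₂ a c q u + vert₂ a c q u' := by
    simp only [vert₂, Prod.fst_add, Prod.snd_add, fib_add_right]
    ring
  simp only [chr, h1, h2, Prod.fst_add, Prod.snd_add, chrComp_add_left, Prod.mk_add_mk]

theorem chr_sub_left (q u u' v : Amb n p) :
    chr a c q (u - u') v = chr a c q u v - chr a c q u' v := by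
  rw [eq_sub_iff_add_eq, ← chr_add_left, sub_add_cancel]

theorem chr_add_right (q u v v' : Amb n p) :
    chr a c q u (v + v') = chr a c q u v + chr a c q u v' := by
  rw [chr_swap, chr_add_left, chr_swap a c q v, chr_swap a c q v']

/-- The derivative of `chr` with respect to the base point. -/
def chrD (a c : ℝ) (q q' u v : Amb n p) : Amb n p :=
  (chrCompD q.1 q'.1 u.1 v.1 (vert₁ a c q u) (vert₁ a c q v) (vert₁ a c q' u) (vert₁ a c q' v),
    chrCompD q.2 q'.2 u.2 v.2 (vert₂ a c q u) (vert₂ a c q v) (vert₂ a c q' u) (vert₂ a c q' v))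

theorem hasDerivAt_chr {q u v : ℝ → Amb n p} {q' u' v' : Amb n p} {t : ℝ}
    (hq : HasDerivAt q q' t) (hu : HasDerivAt u u' t) (hv : HasDerivAt v v' t) :
    HasDerivAt (fun t => chr a c (q t) (u t) (v t))
      (chrD a c (q t) q' (u t) (v t) + chr a c (q t) u' (v t) + chr a c (q t) (u t) v') t := by
  refine ((hasDerivAt_chrComp (hasDerivAt_fst hq) (hasDerivAt_fst hu) (hasDerivAt_fst hv)
    (hasDerivAt_vert₁ hq hu) (hasDerivAt_vert₁ hq hv)).prodMk
    (hasDerivAt_chrComp (hasDerivAt_snd hq) (hasDerivAt_snd hu) (hasDerivAt_snd hv)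
    (hasDerivAt_vert₂ hq hu) (hasDerivAt_vert₂ hq hv))).congr_deriv ?_
  refine Prod.ext ?_ ?_
  · simp only [chrD, chr, chrCompD, chrComp, Prod.fst_add, Complex.ofReal_add, Complex.add_re]
    module
  · simp only [chrD, chr, chrCompD, chrComp, Prod.snd_add, Complex.ofReal_add, Complex.add_re]
    module

variable {D : CovariantDerivative (Mdl n p) (Model n p) (TangentSpace (Mdl n p) : Mfd n p → Type _)}
  {X Y W : (q : Mfd n p) → TangentSpace (Mdl n p) q}

theorem ambient_cov_apply (hc : 0 < c) (hD : IsLeviCivita D (metric a c))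
    (hY : IsSmoothVectorField Y) (q : Mfd n p) (v : TangentSpace (Mdl n p) q) :
    ambient q (D Y q v) =
      mvfderiv (Mdl n p) (hat Y) q v + chr a c (incl q) (ambient q v) (hat Y q) := by
  obtain ⟨X, hX, rfl⟩ := exists_isSmoothVectorField v
  exact ambient_cov hc hD hX hY q

/-- The formula for the connection is applied to the field `D_Y W`, whose ambient expression is
known at every point and is differentiated along a coordinate line. -/
theorem ambient_cov_cov (hc : 0 < c) (hD : IsLeviCivita D (metric a c))
    (hY : IsSmoothVectorField Y) (hW : IsSmoothVectorField W) (q : Mfd n p) :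
    ambient q (D (fun y => D W y (Y y)) q (X q)) =
      mvfderiv (Mdl n p) (fun y => mvfderiv (Mdl n p) (hat W) y (Y y)) q (X q)
      + chrD a c (incl q) (hat X q) (hat Y q) (hat W q)
      + chr a c (incl q) (mvfderiv (Mdl n p) (hat Y) q (X q)) (hat W q)
      + chr a c (incl q) (hat Y q) (mvfderiv (Mdl n p) (hat W) q (X q))
      + chr a c (incl q) (hat X q) (mvfderiv (Mdl n p) (hat W) q (Y q))
      + chr a c (incl q) (hat X q) (chr a c (incl q) (hat Y q) (hat W q)) := by
  have hS := isSmoothVectorField_cov hD hY hW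
  have e : coordLine (Mdl n p) q (X q) 0 = q := coordLine_zero (E := Model n p) q (X q)
  have hf : hat (fun y => D W y (Y y)) = fun y => mvfderiv (Mdl n p) (hat W) y (Y y)
      + chr a c (incl y) (hat Y y) (hat W y) := funext fun y => ambient_cov hc hD hY hW y
  have h1 := (((hY.contMDiff_mvfderiv (contMDiff_hat hW)).mdifferentiable (by simp)
    q).hasDerivAt_coordLine (X q)).add (hasDerivAt_chr (a := a) (c := c) (hasDerivAt_incl q (X q))
      (hasDerivAt_hat hY q (X q)) (hasDerivAt_hat hW q (X q)))
  have h2 := hasDerivAt_hat hS q (X q)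
  have h3 := h2.unique (h1.congr_of_eventuallyEq (Filter.Eventually.of_forall fun t => by rw [hf]; rfl))
  rw [e] at h3
  rw [ambient_cov_apply hc hD hS, h3, hf, chr_add_right]
  simp only [hat]
  abel

/-- The curvature of `g(a, c)` in the ambient space. -/
theorem ambient_curvature (hc : 0 < c) (hD : IsLeviCivita D (metric a c))
    (hX : IsSmoothVectorField X) (hY : IsSmoothVectorField Y) (hW : IsSmoothVectorField W)
    (q : Mfd n p) :
    ambient q (curvature D X Y W q) =
      chrD a c (incl q) (hat X q) (hat Y q) (hat W q)
      - chrD a c (incl q) (hat Y q) (hat X q) (hat W q)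
      + chr a c (incl q) (hat X q) (chr a c (incl q) (hat Y q) (hat W q))
      - chr a c (incl q) (hat Y q) (chr a c (incl q) (hat X q) (hat W q)) := by
  have hb : ambient q (VectorField.mlieBracket (Mdl n p) X Y q) =
      mvfderiv (Mdl n p) (hat Y) q (X q) - mvfderiv (Mdl n p) (hat X) q (Y q) :=
    mvfderiv_mlieBracket contMDiff_incl hX hY q
  have hs : ∀ u v : TangentSpace (Mdl n p) q, ambient q (u - v) = ambient q u - ambient q v :=
    fun u v => map_sub (mvfderiv (Mdl n p) (incl (n := n) (p := p)) q) u v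
  -- The bracket term absorbs the second derivatives of `hat W` and the first derivatives of `hat X`
  -- and `hat Y`; the terms with first derivatives of `hat W` cancel in pairs.
  rw [curvature, hs, hs, ambient_cov_cov hc hD hY hW, ambient_cov_cov hc hD hX hW,
    ambient_cov_apply hc hD hW, hb, mvfderiv_mlieBracket (contMDiff_hat hW) hX hY, chr_sub_left]
  abel

/-! ### Curvature with first argument tangent to the torus fibre -/

section Algebra

variable {m : ℕ}

/-- The two factors interact only through `vert₁` and `vert₂`, so with these values as free
parameters each factor can be treated alone. The parameter `σ` drops out because it multiplies the
horizontal part of a fibre vector. -/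
theorem curvature_component {z h k : Cn m} (hz : ‖z‖ = 1) (hh : inner ℂ z h = 0)
    (hk : inner ℂ z k = 0) (r y w su sy sw σ : ℝ) :
    chrCompD z (((r : ℂ) * Complex.I) • z) (((y : ℂ) * Complex.I) • z + h)
        (((w : ℂ) * Complex.I) • z + k) sy sw 0 0
      - chrCompD z (((y : ℂ) * Complex.I) • z + h) (((r : ℂ) * Complex.I) • z)
        (((w : ℂ) * Complex.I) • z + k) su sw 0 σ
      + chrComp z (((r : ℂ) * Complex.I) • z)
        (chrComp z (((y : ℂ) * Complex.I) • z + h) (((w : ℂ) * Complex.I) • z + k) sy sw) su 0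
      - chrComp z (((y : ℂ) * Complex.I) • z + h)
        (chrComp z (((r : ℂ) * Complex.I) • z) (((w : ℂ) * Complex.I) • z + k) su sw) sy 0 =
    ((su + r : ℝ) : ℂ) • ((((inner ℂ h k).re : ℂ) * Complex.I) • z - ((sw + w : ℝ) : ℂ) • h) := by
  have hh' : inner ℂ h z = (0 : ℂ) := inner_eq_zero_symm.1 hh
  have h0 : ∀ r : ℝ, hor z (((r : ℂ) * Complex.I) • z) = 0 := by
    intro r
    simp [hor, hz]
  have h1 : hor z h = h := by simp [hor, hh]
  have h2 : hor z k = k := by simp [hor, hk]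
  have h5 : hor z 0 = 0 := by simp [hor]
  have h4 : hor z z = 0 := by simp [hor, hz]
  have h3 : ∀ (α : ℂ) (v : Cn m), hor z (α • v) = α • hor z v := by
    intro α v
    simp only [hor, inner_smul_right]
    module
  generalize hζ : (inner ℂ h k : ℂ) = ζ
  simp only [chrCompD, chrComp, hor_add, h0, h1, h2, h3, h4, h5, inner_add_left, inner_add_right,
    inner_smul_left, inner_smul_right, hh, hk, hh', inner_self_eq_norm_sq_to_K, hz, hζ]
  match_scalars <;> apply Complex.ext <;> simp <;> ring

end Algebra

end SphereProduct

namespace SphereProduct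

section Algebra

variable {m : ℕ}

theorem eq_fib_smul_add_hor {z v : Cn m} (hv : (inner ℂ z v).re = 0) :
    v = ((fib z v : ℂ) * Complex.I) • z + hor z v := by
  have h : inner ℂ z v = (fib z v : ℂ) * Complex.I := by
    apply Complex.ext <;> simp [fib, hv]
  rw [hor, h]
  abel

theorem fib_smul_I_left {z v : Cn m} (hv : (inner ℂ z v).re = 0) (r : ℝ) :
    fib (((r : ℂ) * Complex.I) • z) v = 0 := by
  simp [fib, hv]

theorem curvature_component_of_tangent {z u v w : Cn m} (hz : ‖z‖ = 1) {r : ℝ}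
    (hu : u = ((r : ℂ) * Complex.I) • z) (hv : (inner ℂ z v).re = 0) (hw : (inner ℂ z w).re = 0)
    (su sv sw σ : ℝ) :
    chrCompD z u v w sv sw 0 0 - chrCompD z v u w su sw 0 σ + chrComp z u (chrComp z v w sv sw) su 0
      - chrComp z v (chrComp z u w su sw) sv 0 =
    ((su + r : ℝ) : ℂ) • ((((inner ℂ (hor z v) (hor z w)).re : ℂ) * Complex.I) • z
      - ((sw + fib z w : ℝ) : ℂ) • hor z v) := by
  have h := curvature_component hz (inner_hor hz v) (inner_hor hz w) r (fib z v) (fib z w) su sv sw σ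
  rwa [← eq_fib_smul_add_hor hv, ← eq_fib_smul_add_hor hw, ← hu] at h

theorem re_inner_hor_left {z : Cn m} (hz : ‖z‖ = 1) (v w : Cn m) :
    (inner ℂ (hor z v) w).re = (inner ℂ (hor z v) (hor z w)).re := by
  have h : inner ℂ (hor z v) z = (0 : ℂ) := inner_eq_zero_symm.1 (inner_hor hz v)
  conv_rhs => rw [hor.eq_1 z w, inner_sub_right, inner_smul_right, h, mul_zero, sub_zero]

theorem fib_curvature_component {z : Cn m} (hz : ‖z‖ = 1) (v : Cn m) (β κ ρ : ℝ) :
    fib z ((β : ℂ) • (((κ : ℂ) * Complex.I) • z - (ρ : ℂ) • hor z v)) = β * κ := by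
  simp [fib, inner_hor hz, hz]

theorem re_inner_curvature_component {z x : Cn m} (hz : ‖z‖ = 1) (v : Cn m)
    (β κ ρ : ℝ) :
    (inner ℂ ((β : ℂ) • (((κ : ℂ) * Complex.I) • z - (ρ : ℂ) • hor z v)) x).re =
      β * (κ * fib z x - ρ * (inner ℂ (hor z v) (hor z x)).re) := by
  rw [← re_inner_hor_left hz]
  simp only [inner_smul_left, inner_sub_left, map_mul, Complex.conj_ofReal, Complex.conj_I, fib,
    Complex.sub_re, Complex.mul_re, Complex.mul_im]
  simp

end Algebra

variable {n p : ℕ} {a c : ℝ}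

theorem chr_fst (q u v : Amb n p) :
    (chr a c q u v).1 = chrComp q.1 u.1 v.1 (vert₁ a c q u) (vert₁ a c q v) := rfl

theorem chr_snd (q u v : Amb n p) :
    (chr a c q u v).2 = chrComp q.2 u.2 v.2 (vert₂ a c q u) (vert₂ a c q v) := rfl

/-- The scalar product with `X¹` for the metric `g(a, c)`. -/
def mom₁ (a c : ℝ) (q v : Amb n p) : ℝ := 1 / c * fib q.1 v.1 - a / c * fib q.2 v.2

/-- The scalar product with `X²` for the metric `g(a, c)`. -/
def mom₂ (a c : ℝ) (q v : Amb n p) : ℝ :=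
  -(a / c) * fib q.1 v.1 + (a ^ 2 + c ^ 2) / c * fib q.2 v.2

/-- The curvature of `g(a, c)` when the first vector is tangent to the fibre. -/
theorem gram_curvature {q u v w x : Amb n p} (hq : IsUnit₂ q)
    (hu₁ : u.1 = ((fib q.1 u.1 : ℂ) * Complex.I) • q.1)
    (hu₂ : u.2 = ((fib q.2 u.2 : ℂ) * Complex.I) • q.2)
    (hv : IsTangent q v) (hw : IsTangent q w) :
    gram a c q (chrD a c q u v w - chrD a c q v u w + chr a c q u (chr a c q v w)
        - chr a c q v (chr a c q u w)) x =
      mom₁ a c q u * (mom₁ a c q x * (inner ℂ (hor q.1 v.1) (hor q.1 w.1)).re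
        - mom₁ a c q w * (inner ℂ (hor q.1 v.1) (hor q.1 x.1)).re)
      + mom₂ a c q u * (mom₂ a c q x * (inner ℂ (hor q.2 v.2) (hor q.2 w.2)).re
        - mom₂ a c q w * (inner ℂ (hor q.2 v.2) (hor q.2 x.2)).re) := by
  have k1 : ∀ y, IsTangent q y → fib u.1 y.1 = 0 := fun y hy => by
    rw [hu₁]; exact fib_smul_I_left hy.1 _
  have k2 : ∀ y, IsTangent q y → fib u.2 y.2 = 0 := fun y hy => by
    rw [hu₂]; exact fib_smul_I_left hy.2 _
  have e1 : ∀ y, IsTangent q y → vert₁ a c u y = 0 := fun y hy => by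
    simp [vert₁, k1 y hy, k2 y hy]
  have e2 : ∀ y, IsTangent q y → vert₂ a c u y = 0 := fun y hy => by
    simp [vert₂, k1 y hy, k2 y hy]
  have f1 : vert₁ a c v u = 0 := by
    simp [vert₁, fib_swap v.1, fib_swap v.2, k1 v hv, k2 v hv]
  have f2 : vert₂ a c v u = 0 := by
    simp [vert₂, fib_swap v.1, fib_swap v.2, k1 v hv, k2 v hv]
  -- `vert` vanishes on values of `chr`, and also when the pair of base point and argument consists
  -- of `u` and a tangent vector; these are the zeros in the component formula.
  have hR : chrD a c q u v w - chrD a c q v u w + chr a c q u (chr a c q v w)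
      - chr a c q v (chr a c q u w) =
      (((vert₁ a c q u + fib q.1 u.1 : ℝ) : ℂ) •
        ((((inner ℂ (hor q.1 v.1) (hor q.1 w.1)).re : ℂ) * Complex.I) • q.1
          - ((vert₁ a c q w + fib q.1 w.1 : ℝ) : ℂ) • hor q.1 v.1),
       ((vert₂ a c q u + fib q.2 u.2 : ℝ) : ℂ) •
        ((((inner ℂ (hor q.2 v.2) (hor q.2 w.2)).re : ℂ) * Complex.I) • q.2
          - ((vert₂ a c q w + fib q.2 w.2 : ℝ) : ℂ) • hor q.2 v.2)) := by
    refine Prod.ext ?_ ?_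
    · rw [← curvature_component_of_tangent hq.1 hu₁ hv.1 hw.1 _ (vert₁ a c q v) _ (vert₁ a c v w)]
      have g1 := vert₁_chr a c hq v w
      have g2 := vert₁_chr a c hq u w
      simp only [chrD, e1 v hv, e1 w hw, f1, Prod.fst_sub, Prod.fst_add,
        chr_fst q u, chr_fst q v (chr _ _ _ _ _), g1, g2]
      rfl
    · rw [← curvature_component_of_tangent hq.2 hu₂ hv.2 hw.2 _ (vert₂ a c q v) _ (vert₂ a c v w)]
      have g1 := vert₂_chr a c hq v w
      have g2 := vert₂_chr a c hq u w
      simp only [chrD, e2 v hv, e2 w hw, f2, Prod.snd_sub, Prod.snd_add,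
        chr_snd q u, chr_snd q v (chr _ _ _ _ _), g1, g2]
      rfl
  rw [hR, gram, re_inner_curvature_component hq.1, re_inner_curvature_component hq.2]
  simp only [vert₁, vert₂, fib_curvature_component hq.1, fib_curvature_component hq.2, mom₁, mom₂]
  ring

end SphereProduct

/-! ### The basis at the base point -/

namespace SphereProduct

section Basis

variable {m : ℕ}

/-- The first vector of the standard basis. -/
def e₀ (m : ℕ) : Cn m := EuclideanSpace.single 0 1

/-- The tangent vector `A e₀`. -/
def col (A : Matrix (Fin (m + 1)) (Fin (m + 1)) ℂ) : Cn m := WithLp.toLp 2 (A *ᵥ (e₀ m).ofLp)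

theorem col_apply (A : Matrix (Fin (m + 1)) (Fin (m + 1)) ℂ) (r : Fin (m + 1)) :
    col A r = A r 0 := by
  simp [col, e₀]

theorem col_vX : col (vX m) = Complex.I • e₀ m := by
  ext r
  rw [col_apply]
  by_cases hr : r = 0
  · subst hr
    simp [vX, elem, e₀]
    ring
  · simp [vX, elem, e₀, hr]

/-- For both `k = 2ν - 1` and `k = 2ν` the row `ν` is `(k + 1) / 2`. -/
theorem col_vY_apply {k : ℕ} (hk : 0 < k) (r : Fin (m + 1)) :
    col (vY m k) r = if (r : ℕ) = (k + 1) / 2 then (if Odd k then 1 else Complex.I) else 0 := by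
  rw [col_apply, vY]
  rcases Nat.even_or_odd' k with ⟨j, rfl | rfl⟩
  · have h : ¬ Odd (2 * j) := by simp
    have h1 : (2 * j + 1) / 2 = j := by omega
    have h2 : 0 ≠ j := by omega
    simp [h, h1, elem, h2]
  · have h : Odd (2 * j + 1) := by simp
    have h1 : (2 * j + 1 + 1) / 2 = j + 1 := by omega
    simp [h, h1, elem]

theorem inner_e₀ (v : Cn m) : inner ℂ (e₀ m) v = v 0 := by
  simp [e₀, EuclideanSpace.inner_single_left]

theorem fib_e₀_smul (r : ℝ) : fib (e₀ m) (r • Complex.I • e₀ m) = r := by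
  simp [fib, e₀]

theorem hor_e₀_smul (r : ℝ) : hor (e₀ m) (r • Complex.I • e₀ m) = 0 := by
  rw [hor, inner_e₀]
  ext s
  simp [e₀]

theorem inner_e₀_vY {k : ℕ} (hk : 0 < k) : inner ℂ (e₀ m) (col (vY m k)) = 0 := by
  rw [inner_e₀, col_vY_apply hk, if_neg]
  simp
  omega

theorem fib_e₀_vY {k : ℕ} (hk : 0 < k) : fib (e₀ m) (col (vY m k)) = 0 := by
  rw [fib, inner_e₀_vY hk, Complex.zero_im]

theorem hor_e₀_vY {k : ℕ} (hk : 0 < k) : hor (e₀ m) (col (vY m k)) = col (vY m k) := by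
  rw [hor, inner_e₀_vY hk, zero_smul, sub_zero]

/-- Two distinct columns either occupy different rows or differ by a factor `±i`, so the real part
is zero. The bound on `k` ensures that its row exists; beyond it the column would be zero. -/
theorem re_inner_vY {k l : ℕ} (hk : 0 < k) (hkm : k ≤ 2 * m) (hl : 0 < l) :
    (inner ℂ (col (vY m k)) (col (vY m l))).re = if k = l then 1 else 0 := by
  have hs : inner ℂ (col (vY m k)) (col (vY m l)) =
      col (vY m l) ⟨(k + 1) / 2, by omega⟩ * (if Odd k then 1 else -Complex.I) := by
    rw [PiLp.inner_apply, Finset.sum_eq_single ⟨(k + 1) / 2, by omega⟩]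
    · rw [col_vY_apply hk]
      by_cases h : Odd k <;> simp [h]
    · intro r _ hr
      have : (r : ℕ) ≠ (k + 1) / 2 := fun h => hr (Fin.ext h)
      rw [col_vY_apply hk, if_neg this]
      simp
    · simp
  rw [hs, col_vY_apply hl]
  by_cases h : k = l
  · subst h
    by_cases ho : Odd k <;> simp [ho]
  · rw [if_neg h]
    by_cases ho : Odd k <;> by_cases ho' : Odd l <;> simp [ho, ho'] <;>
      (try split_ifs) <;> simp <;> grind

end Basis

variable {n p : ℕ} {a c : ℝ}

/-- The ambient vector of `Z_k`. -/
def vec (n p : ℕ) (a c : ℝ) (k : ℕ) : Amb n p := act (vZ n p a c k) (incl (base n p))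

theorem incl_base : incl (base n p) = (e₀ n, e₀ p) := rfl

theorem act_base (A : Matrix (Fin (n + 1)) (Fin (n + 1)) ℂ × Matrix (Fin (p + 1)) (Fin (p + 1)) ℂ) :
    act A (incl (base n p)) = (col A.1, col A.2) := rfl

theorem col_smul {m : ℕ} (r : ℝ) (A : Matrix (Fin (m + 1)) (Fin (m + 1)) ℂ) :
    col (r • A) = r • col A := by
  ext s
  simp [col_apply]

theorem col_zero {m : ℕ} : col (0 : Matrix (Fin (m + 1)) (Fin (m + 1)) ℂ) = 0 := by
  ext s
  simp [col_apply]

/-- The zero component is kept as a multiple of `i e₀`, so that `fib_e₀_smul` and `hor_e₀_smul`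
apply to it too. -/
theorem vec_zero : vec n p a c 0 = (√c • Complex.I • e₀ n, (0 : ℝ) • Complex.I • e₀ p) := by
  simp [vec, act_base, vZ, col_smul, col_vX, col_zero]

theorem vec_left {k : ℕ} (h0 : 0 < k) (h : k ≤ 2 * n) :
    vec n p a c k = (col (vY n k), (0 : ℝ) • Complex.I • e₀ p) := by
  simp [vec, act_base, vZ, h0.ne', h, col_zero]

theorem vec_middle : vec n p a c (2 * n + 1) =
    ((a / √c) • Complex.I • e₀ n, (1 / √c) • Complex.I • e₀ p) := by
  simp [vec, act_base, vZ, col_smul, col_vX]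

theorem vec_right {k : ℕ} (h : 2 * n + 2 ≤ k) :
    vec n p a c k = ((0 : ℝ) • Complex.I • e₀ n, col (vY p (k - (2 * n + 1)))) := by
  have h1 : k ≠ 0 := by omega
  have h2 : ¬ k ≤ 2 * n := by omega
  have h3 : k ≠ 2 * n + 1 := by omega
  simp [vec, act_base, vZ, h1, h2, h3, col_zero]

theorem index_cases (n k : ℕ) :
    k = 0 ∨ (0 < k ∧ k ≤ 2 * n) ∨ k = 2 * n + 1 ∨ 2 * n + 2 ≤ k := by omega

theorem fib_vec_fst (k : ℕ) : fib (e₀ n) (vec n p a c k).1 =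
    if k = 0 then √c else if k = 2 * n + 1 then a / √c else 0 := by
  rcases index_cases n k with rfl | ⟨h0, h⟩ | rfl | h
  ·     rw [vec_zero, fib_e₀_smul, if_pos rfl]
  · rw [vec_left h0 h, fib_e₀_vY h0, if_neg (by omega), if_neg (by omega)]
  · rw [vec_middle, fib_e₀_smul, if_neg (by omega), if_pos rfl]
  · rw [vec_right h, fib_e₀_smul, if_neg (by omega), if_neg (by omega)]

theorem fib_vec_snd (k : ℕ) : fib (e₀ p) (vec n p a c k).2 =
    if k = 2 * n + 1 then 1 / √c else 0 := by
  rcases index_cases n k with rfl | ⟨h0, h⟩ | rfl | h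
  ·     rw [vec_zero, fib_e₀_smul, if_neg (by omega)]
  · rw [vec_left h0 h, fib_e₀_smul, if_neg (by omega)]
  · rw [vec_middle, fib_e₀_smul, if_pos rfl]
  · rw [vec_right h, fib_e₀_vY (by omega), if_neg (by omega)]

theorem hor_vec_fst (k : ℕ) : hor (e₀ n) (vec n p a c k).1 =
    if 0 < k ∧ k ≤ 2 * n then col (vY n k) else 0 := by
  rcases index_cases n k with rfl | ⟨h0, h⟩ | rfl | h
  ·     rw [vec_zero, hor_e₀_smul, if_neg (by omega)]
  · rw [vec_left h0 h, hor_e₀_vY h0, if_pos ⟨h0, h⟩]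
  · rw [vec_middle, hor_e₀_smul, if_neg (by omega)]
  · rw [vec_right h, hor_e₀_smul, if_neg (by omega)]

theorem hor_vec_snd (k : ℕ) : hor (e₀ p) (vec n p a c k).2 =
    if 2 * n + 2 ≤ k then col (vY p (k - (2 * n + 1))) else 0 := by
  rcases index_cases n k with rfl | ⟨h0, h⟩ | rfl | h
  ·     rw [vec_zero, hor_e₀_smul, if_neg (by omega)]
  · rw [vec_left h0 h, hor_e₀_smul, if_neg (by omega)]
  · rw [vec_middle, hor_e₀_smul, if_neg (by omega)]
  · rw [vec_right h, hor_e₀_vY (by omega), if_pos h]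

/-- `X¹ = Z_0 / √c`, so only `Z_0` has a nonzero product with it. -/
theorem mom₁_vec (hc : 0 < c) (k : ℕ) : mom₁ a c (e₀ n, e₀ p) (vec n p a c k) =
    if k = 0 then 1 / √c else 0 := by
  have hs : √c ≠ 0 := (Real.sqrt_pos.2 hc).ne'
  have h2 : √c ^ 2 = c := Real.sq_sqrt hc.le
  simp only [mom₁, fib_vec_fst, fib_vec_snd]
  split_ifs with h1 h3
  · omega
  · field_simp
    linear_combination h2
  · ring
  · ring

/-- These are the coefficients in `X² = √c Z_{2n+1} - (a / √c) Z_0`. -/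
theorem mom₂_vec (hc : 0 < c) (k : ℕ) : mom₂ a c (e₀ n, e₀ p) (vec n p a c k) =
    if k = 0 then -(a / √c) else if k = 2 * n + 1 then √c else 0 := by
  have hs : √c ≠ 0 := (Real.sqrt_pos.2 hc).ne'
  have h2 : √c ^ 2 = c := Real.sq_sqrt hc.le
  simp only [mom₂, fib_vec_fst, fib_vec_snd]
  split_ifs with h1 h3
  · omega
  · field_simp
    linear_combination -a * h2
  · field_simp
    linear_combination -c * h2
  · ring

theorem re_inner_hor_vec_fst (k l : ℕ) :
    (inner ℂ (hor (e₀ n) (vec n p a c k).1) (hor (e₀ n) (vec n p a c l).1)).re =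
      if 0 < k ∧ k ≤ 2 * n ∧ k = l then 1 else 0 := by
  rw [hor_vec_fst, hor_vec_fst]
  by_cases hk : 0 < k ∧ k ≤ 2 * n
  · by_cases hl : 0 < l ∧ l ≤ 2 * n
    · rw [if_pos hk, if_pos hl, re_inner_vY hk.1 hk.2 hl.1]
      simp [hk.1, hk.2]
    · rw [if_neg hl, inner_zero_right, if_neg (by omega), Complex.zero_re]
  · rw [if_neg hk, inner_zero_left, if_neg (by omega), Complex.zero_re]

theorem re_inner_hor_vec_snd {k : ℕ} (hk' : k ≤ 2 * n + 2 * p + 1) (l : ℕ) :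
    (inner ℂ (hor (e₀ p) (vec n p a c k).2) (hor (e₀ p) (vec n p a c l).2)).re =
      if 2 * n + 2 ≤ k ∧ k = l then 1 else 0 := by
  rw [hor_vec_snd, hor_vec_snd]
  by_cases hk : 2 * n + 2 ≤ k
  · by_cases hl : 2 * n + 2 ≤ l
    · rw [if_pos hk, if_pos hl, re_inner_vY (by omega) (by omega) (by omega)]
      exact if_congr (by omega) rfl rfl
    · rw [if_neg hl, inner_zero_right, if_neg (by omega), Complex.zero_re]
  · rw [if_neg hk, inner_zero_left, if_neg (by omega), Complex.zero_re]

theorem eq_of_hor_eq_zero {m : ℕ} {z v : Cn m} (hv : (inner ℂ z v).re = 0) (h : hor z v = 0) :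
    v = ((fib z v : ℂ) * Complex.I) • z := by
  have h1 := eq_fib_smul_add_hor hv
  rwa [h, add_zero] at h1

theorem curvComp_eq (hc : 0 < c)
    {D : CovariantDerivative (Mdl n p) (Model n p) (TangentSpace (Mdl n p) : Mfd n p → Type _)}
    (hD : IsLeviCivita D (metric a c))
    {Z : ℕ → (q : Mfd n p) → TangentSpace (Mdl n p) q}
    (hZsmooth : ∀ k ≤ 2 * n + 2 * p + 1, IsSmoothVectorField (Z k))
    (hZbase : ∀ k ≤ 2 * n + 2 * p + 1, Represents (Z k (base n p)) (vZ n p a c k))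
    {α ν ρ μ : ℕ} (hα : α = 0 ∨ α = 2 * n + 1) (hν : ν ≤ 2 * n + 2 * p + 1) (hρμ : ρ < μ)
    (hμ : μ ≤ 2 * n + 2 * p + 1) :
    curvComp a c D Z α ν ρ μ =
      (if α = 0 then 1 / √c else 0) * ((if ρ = 0 then 1 / √c else 0) *
        (if 0 < ν ∧ ν ≤ 2 * n ∧ ν = μ then 1 else 0))
      + (if α = 0 then -(a / √c) else √c) *
        ((if ρ = 0 then -(a / √c) else if ρ = 2 * n + 1 then √c else 0) *
        (if 2 * n + 2 ≤ ν ∧ ν = μ then 1 else 0)) := by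
  have hα' : α ≤ 2 * n + 2 * p + 1 := by omega
  have hρ : ρ ≤ 2 * n + 2 * p + 1 := by omega
  have hv : ∀ k ≤ 2 * n + 2 * p + 1, hat (Z k) (base n p) = vec n p a c k := fun k hk => hZbase k hk
  have ht : ∀ k ≤ 2 * n + 2 * p + 1, IsTangent (incl (base n p)) (vec n p a c k) := fun k hk => by
    rw [← hv k hk]
    exact isTangent_ambient _ _
  have hx : ambient (base n p) (Z ρ (base n p)) = vec n p a c ρ := hv ρ hρ
  have hh₁ : hor (e₀ n) (vec n p a c α).1 = 0 := by
    rw [hor_vec_fst, if_neg (by omega)]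
  have hh₂ : hor (e₀ p) (vec n p a c α).2 = 0 := by
    rw [hor_vec_snd, if_neg (by omega)]
  rw [curvComp, metric_eq_gram, ambient_curvature hc hD (hZsmooth α hα') (hZsmooth ν hν)
    (hZsmooth μ hμ), hx, hv α hα', hv ν hν, hv μ hμ,
    gram_curvature (isUnit₂_incl _) (eq_of_hor_eq_zero (ht α hα').1 hh₁)
      (eq_of_hor_eq_zero (ht α hα').2 hh₂) (ht ν hν) (ht μ hμ), incl_base]
  simp only [mom₁_vec hc, mom₂_vec hc, re_inner_hor_vec_fst, re_inner_hor_vec_snd hν]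
  have h1 : μ ≠ 0 := by omega
  -- The ordering `ρ < μ` is used here: `μ = 2n + 1` excludes `ρ ≥ 2n + 2`. In the same way `μ ≠ 0`
  -- removes the other subtracted terms.
  have h2 : (if μ = 2 * n + 1 then √c else 0) * (if 2 * n + 2 ≤ ν ∧ ν = ρ then (1 : ℝ) else 0) = 0 := by
    by_cases h : μ = 2 * n + 1
    · rw [if_neg (show ¬ (2 * n + 2 ≤ ν ∧ ν = ρ) by omega), mul_zero]
    · rw [if_neg h, zero_mul]
  have h3 : (if α = 0 then -(a / √c) else if α = 2 * n + 1 then √c else 0) =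
      if α = 0 then -(a / √c) else √c := by
    rcases hα with rfl | rfl <;> simp
  rw [if_neg h1, if_neg h1, h2, h3, zero_mul, sub_zero, sub_zero]

end SphereProduct
end

/-! ### The table of curvature components -/

open SphereProduct in
theorem proposition3 (n p : ℕ) (a c : ℝ) (hc : 0 < c)
    (D : CovariantDerivative (Mdl n p) (Model n p) (TangentSpace (Mdl n p) : Mfd n p → Type _))
    (hD : IsLeviCivita D (metric a c))
    (Z : ℕ → (q : Mfd n p) → TangentSpace (Mdl n p) q)
    (hZsmooth : ∀ k ≤ 2 * n + 2 * p + 1, IsSmoothVectorField (Z k))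
    (hZbase : ∀ k ≤ 2 * n + 2 * p + 1, Represents (Z k (base n p)) (vZ n p a c k)) :
    (∀ ν ρ μ : ℕ, 0 < ν → ν ≤ 2 * n + 2 * p + 1 → ρ < μ → μ ≤ 2 * n + 2 * p + 1 →
      curvComp a c D Z 0 ν ρ μ =
        if ρ = 0 ∧ ν = μ ∧ 1 ≤ ν ∧ ν ≤ 2 * n then 1 / c
        else if ρ = 0 ∧ ν = μ ∧ 2 * n + 2 ≤ ν then a ^ 2 / c
        else if ρ = 2 * n + 1 ∧ ν = μ ∧ 2 * n + 2 ≤ ν then -a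
        else 0) ∧
    (∀ ν ρ μ : ℕ, 2 * n + 1 < ν → ν ≤ 2 * n + 2 * p + 1 → ρ < μ → μ ≤ 2 * n + 2 * p + 1 →
      curvComp a c D Z (2 * n + 1) ν ρ μ =
        if ρ = 0 ∧ ν = μ ∧ 2 * n + 2 ≤ ν then -a
        else if ρ = 2 * n + 1 ∧ ν = μ ∧ 2 * n + 2 ≤ ν then c
        else 0) := by
  have hs : √c ≠ 0 := (Real.sqrt_pos.2 hc).ne'
  have h2 : √c ^ 2 = c := Real.sq_sqrt hc.le
  have e1 : 1 / √c * (1 / √c) = 1 / c := by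
    field_simp
    rw [h2]
  have e2 : -(a / √c) * -(a / √c) = a ^ 2 / c := by
    field_simp
    rw [h2]
  have e3 : -(a / √c) * √c = -a := by field_simp
  have e4 : √c * √c = c := Real.mul_self_sqrt hc.le
  refine ⟨fun ν ρ μ h0 hν hρμ hμ => ?_, fun ν ρ μ h0 hν hρμ hμ => ?_⟩
  · rw [curvComp_eq hc hD hZsmooth hZbase (Or.inl rfl) hν hρμ hμ, if_pos rfl, if_pos rfl]
    split_ifs <;> first
      | omega
      | linear_combination e1
      | linear_combination e2
      | linear_combination e3
      | ring
  · rw [curvComp_eq hc hD hZsmooth hZbase (Or.inr rfl) hν hρμ hμ,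
      if_neg (Nat.succ_ne_zero _), if_neg (Nat.succ_ne_zero _)]
    split_ifs <;> first
      | omega
      | linear_combination e3
      | linear_combination e4
      | ring
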